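/- Let $C$ be a smooth, projective, geometrically connected curve over a finite field $\mathbb{F}_q$ with $q$ odd, and let $K=\mathbb{F}_q(C)$ be its function field (a finitely generated extension of $\mathbb{F}_q$ of transcendence degree $1$ in which $\mathbb{F}_q$ is algebraically closed). The primes $\mathfrak p$ of $K$ are the closed points of $C$, i.e. the discrete valuation rings of $K$ containing $\mathbb{F}_q$; write $\hat K_{\mathfrak p}$ for the completion of $K$ at $\mathfrak p$ and $\hat{\mathcal O}_{\mathfrak p}$ for its valuation ring. Fix a prime $\infty$ and let $\mathcal{O}_{\{\infty\}}=\{a\in K : v_{\mathfrak p}(a)\ge 0 \text{ for all } \mathfrak p\neq\infty\}$. An integral form of rank $n\ge 0$ is a symmetric bilinear form $f:V\times V\to\mathcal{O}_{\{\infty\}}$ on $V=\mathcal{O}_{\{\infty\}}^n$. Two bilinear forms $f,g$ on a free module $R^n$ are isomorphic over $R$ if there is $Q\in \mathbf{GL}_n(R)$ with $f(u,v)=g(Qu,Qv)$ for all $u,v$. The genus $\mathrm{gen}(f)$ is the set of integral forms $g$ on $V$ that are isomorphic to $f$ over $K$ and over $\hat{\mathcal O}_{\mathfrak p}$ for every prime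 $\mathfrak p\neq\infty$, and $c(f)$ denotes the number (cardinality) of $\mathcal{O}_{\{\infty\}}$-isomorphism classes in $\mathrm{gen}(f)$. Let $F$ be the Gram matrix of $f$ and let $\underline{\mathbf O}_V$ be the stabilizer of $F$ in $\underline{\mathbf{GL}}_n$ under $g*F=g^tFg$, so that $\underline{\mathbf O}_V(R)=\{g\in\mathbf{GL}_n(R): g^tFg=F\}$ for every $\mathcal{O}_{\{\infty\}}$-algebra $R$. Its adelic group $\underline{\mathbf O}_V(\mathbb A)$ is the restricted product of the groups $\underline{\mathbf O}_V(\hat K_{\mathfrak p})$ over all primes $\mathfrak p$ of $K$, with respect to the subgroups $\underline{\mathbf O}_V(\hat{\mathcal O}_{\mathfrak p})$, $\mathfrak p\ne\infty$. Put $\underline{\mathbf O}_V(\mathbb A_\infty)=\underline{\mathbf O}_V(\hat K_\infty)\times\prod_{\mathfrak p\neq\infty}\underline{\mathbf O}_V(\hat{\mathcal O}_{\mathfrak p})$ and embed $\underline{\mathbf O}_V(K)$ diagonally. The class number $h_\infty(\underline{\mathbf O}_V)$ is the cardinality of the set of double cosets $\underline{\mathbf O}_V(\mathbb A_\infty)\backslash\underline{\mathbf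 O}_V(\mathbb A)/\underline{\mathbf O}_V(K)$. Then for every non-degenerate integral form $f$ of any rank $n$ (that is, $\det F\neq 0$; in particular for every unimodular $f$), the cardinalities $c(f)$ and $h_\infty(\underline{\mathbf O}_V)$ are equal: $$c(f)=h_\infty(\underline{\mathbf O}_V).$$ -/

import Mathlib

open scoped RestrictedProduct

namespace FunctionFieldForms

/-- `K` is the function field of a smooth, projective, geometrically connected curve over the
finite field `F`: it is finitely generated of transcendence degree one over `F`, and `F` is
algebraically closed in `K`. -/
structure IsCurveFunctionField (F K : Type*) [Field F] [Field K] [Algebra F K] : Prop where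
  essFiniteType : Algebra.EssFiniteType F K
  trdeg_eq_one : Algebra.trdeg F K = 1
  algebraicClosure_eq_bot : algebraicClosure F K = ⊥

/-- A prime of `K` (equivalently, a closed point of the curve with function field `K`): a discrete
valuation ring of `K / F`, that is, a discrete valuation ring with fraction field `K` which
contains the constant field `F`. -/
structure FFPrime (F K : Type*) [Field F] [Field K] [Algebra F K] where
  /-- The valuation ring `{a | 0 ≤ v(a)}` of the prime, inside `K`. -/
  valRing : ValuationSubring K
  algebraMap_mem : ∀ c : F, algebraMap F K c ∈ valRing
  isDVR : IsDiscreteValuationRing valRing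

attribute [instance] FFPrime.isDVR

section Primes

variable {F K : Type*} [Field F] [Field K] [Algebra F K]

/-- The completion of `K` at the prime `p`. -/
abbrev FFPrime.Completion (p : FFPrime F K) : Type _ :=
  (IsDiscreteValuationRing.maximalIdeal p.valRing).adicCompletion K

/-- The valuation ring of the completion of `K` at the prime `p`. -/
noncomputable abbrev FFPrime.completionIntegers (p : FFPrime F K) : ValuationSubring p.Completion :=
  (IsDiscreteValuationRing.maximalIdeal p.valRing).adicCompletionIntegers K

/-- The ring of `{∞}`-integers of `K`: the elements `a` with `0 ≤ v_p(a)` for all `p ≠ ∞`. -/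
def integersAwayFrom (infty : FFPrime F K) : Subring K where
  carrier := {a | ∀ p : FFPrime F K, p ≠ infty → a ∈ p.valRing}
  mul_mem' ha hb p hp := mul_mem (ha p hp) (hb p hp)
  one_mem' p _ := one_mem p.valRing
  add_mem' ha hb p hp := add_mem (ha p hp) (hb p hp)
  zero_mem' p _ := zero_mem p.valRing
  neg_mem' ha p hp := neg_mem (ha p hp)

/-- The embedding of the `{∞}`-integers into the completion of `K` at an arbitrary prime. -/
noncomputable def toCompletion (infty p : FFPrime F K) :
    integersAwayFrom infty →+* p.Completion :=
  (algebraMap K p.Completion).comp (integersAwayFrom infty).subtype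

/-- The inclusion of the `{∞}`-integers in the valuation ring of a prime `p ≠ ∞`. -/
def toValRing (infty p : FFPrime F K) (hp : p ≠ infty) :
    integersAwayFrom infty →+* p.valRing :=
  (integersAwayFrom infty).subtype.codRestrict p.valRing.toSubring (fun a => a.2 p hp)

/-- The embedding of the `{∞}`-integers into the complete valuation ring at a prime `p ≠ ∞`. -/
noncomputable def toCompletionIntegers (infty p : FFPrime F K) (hp : p ≠ infty) :
    integersAwayFrom infty →+* p.completionIntegers :=
  (algebraMap p.valRing p.completionIntegers).comp (toValRing infty p hp)

end Primes

section Forms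

variable {R : Type*} [CommRing R] {n : ℕ}

/-- Two bilinear forms `f`, `g` on `R ^ n` are isomorphic over `R`: there is `Q` in `GL (R ^ n)`
with `f (u, v) = g (Q u, Q v)`. -/
def FormIso (f g : LinearMap.BilinForm R (Fin n → R)) : Prop :=
  ∃ Q : (Fin n → R) ≃ₗ[R] (Fin n → R), ∀ u v, f u v = g (Q u) (Q v)

theorem FormIso.equivalence : Equivalence (FormIso (R := R) (n := n)) where
  refl f := ⟨LinearEquiv.refl R _, fun _ _ => rfl⟩
  symm := by
    rintro f g ⟨Q, hQ⟩
    exact ⟨Q.symm, fun u v => by simp [hQ]⟩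
  trans := by
    rintro f g h ⟨Q, hQ⟩ ⟨P, hP⟩
    exact ⟨Q.trans P, fun u v => by simp [hQ, hP]⟩

/-- Extension of scalars of a bilinear form on `R ^ n` along `φ : R → S`: the form on `S ^ n`
with the same Gram matrix in the standard basis. -/
noncomputable def extendForm {S : Type*} [CommRing S] (φ : R →+* S)
    (f : LinearMap.BilinForm R (Fin n → R)) : LinearMap.BilinForm S (Fin n → S) :=
  Matrix.toBilin' ((LinearMap.BilinForm.toMatrix' f).map φ)

/-- The `S`-points of the orthogonal group scheme of the form `f` with Gram matrix `A`, for an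
`R`-algebra `φ : R → S`: the stabilizer of `A` under the action `(g, A) ↦ gᵀ A g`. -/
def orthogonalPoints {S : Type*} [CommRing S] (φ : R →+* S)
    (f : LinearMap.BilinForm R (Fin n → R)) : Subgroup (GL (Fin n) S) where
  carrier := {g | (g : Matrix (Fin n) (Fin n) S).transpose *
    (LinearMap.BilinForm.toMatrix' f).map φ * (g : Matrix (Fin n) (Fin n) S) =
      (LinearMap.BilinForm.toMatrix' f).map φ}
  mul_mem' {a b} ha hb := by
    simp only [Set.mem_ofPred_eq, Units.val_mul, Matrix.transpose_mul] at ha hb ⊢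
    calc _ = (b : Matrix (Fin n) (Fin n) S).transpose *
          ((a : Matrix (Fin n) (Fin n) S).transpose *
            (LinearMap.BilinForm.toMatrix' f).map φ * (a : Matrix (Fin n) (Fin n) S)) *
          (b : Matrix (Fin n) (Fin n) S) := by simp only [Matrix.mul_assoc]
      _ = _ := by rw [ha, hb]
  one_mem' := by simp
  inv_mem' {a} ha := by
    simp only [Set.mem_ofPred_eq] at ha ⊢
    have h1 : (a : Matrix (Fin n) (Fin n) S) * ((a⁻¹ : GL (Fin n) S) : Matrix _ _ S) = 1 :=
      Units.mul_inv a
    have h2 : ((a⁻¹ : GL (Fin n) S) : Matrix _ _ S).transpose *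
        (a : Matrix (Fin n) (Fin n) S).transpose = 1 := by
      rw [← Matrix.transpose_mul, h1, Matrix.transpose_one]
    conv_lhs => rw [← ha]
    simp only [Matrix.mul_assoc, h1, Matrix.mul_one]
    rw [← Matrix.mul_assoc, h2, Matrix.one_mul]

end Forms

section Genus

variable {F K : Type*} [Field F] [Field K] [Algebra F K] (infty : FFPrime F K) {n : ℕ}

/-- Integral forms of rank `n`: symmetric bilinear forms on the free module of rank `n` over the
ring of `{∞}`-integers. -/
abbrev IntegralForm (n : ℕ) : Type _ :=
  {f : LinearMap.BilinForm (integersAwayFrom infty) (Fin n → integersAwayFrom infty) // f.IsSymm}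

variable {infty}

/-- `f` and `g` have the same genus: they are isomorphic over `K` and over the complete valuation
ring at every prime `p ≠ ∞`, i.e. at every prime of the ring of `{∞}`-integers. -/
def SameGenus (f g : IntegralForm infty n) : Prop :=
  FormIso (extendForm (integersAwayFrom infty).subtype f.1)
      (extendForm (integersAwayFrom infty).subtype g.1) ∧
    ∀ (p : FFPrime F K) (hp : p ≠ infty),
      FormIso (extendForm (toCompletionIntegers infty p hp) f.1)
        (extendForm (toCompletionIntegers infty p hp) g.1)

/-- The genus of `f`: all integral forms of the same genus as `f`. -/
abbrev Genus (f : IntegralForm infty n) : Type _ :=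
  {g : IntegralForm infty n // SameGenus f g}

/-- Isomorphism over the ring of `{∞}`-integers, on the genus of `f`. -/
def genusSetoid (f : IntegralForm infty n) : Setoid (Genus f) where
  r g h := FormIso g.1.1 h.1.1
  iseqv := ⟨fun _ => FormIso.equivalence.refl _, FormIso.equivalence.symm,
    FormIso.equivalence.trans⟩

/-- `c(f)`: the number of isomorphism classes, over the ring of `{∞}`-integers, in the genus
of `f`, as a cardinal. -/
noncomputable def genusClassCard (f : IntegralForm infty n) : Cardinal :=
  Cardinal.mk (Quotient (genusSetoid f))

/-- The points of the orthogonal group scheme of `f` over the completion of `K` at `p`. -/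
noncomputable abbrev LocalPoints (f : IntegralForm infty n) (p : FFPrime F K) :
    Subgroup (GL (Fin n) p.Completion) :=
  orthogonalPoints (toCompletion infty p) f.1

/-- The subgroup of those local points at `p` which have entries in the complete valuation ring,
as does their inverse. For `p ≠ ∞` these are the points of the orthogonal group scheme of `f` over
the complete valuation ring at `p`. -/
noncomputable def integralLocalPoints (f : IntegralForm infty n) (p : FFPrime F K) :
    Subgroup (LocalPoints f p) :=
  (Matrix.GeneralLinearGroup.map (n := Fin n)
    p.completionIntegers.subtype).range.subgroupOf (LocalPoints f p)

/-- The adelic points of the orthogonal group scheme of `f`: the restricted product, over all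
primes `p` of `K` (including `∞`), of the local points with respect to the integral ones. -/
abbrev AdelicPoints (f : IntegralForm infty n) : Type _ :=
  Πʳ p : FFPrime F K, [LocalPoints f p, integralLocalPoints f p]

/-- The subgroup of points over the ring `K_∞ × ∏_{p ≠ ∞} O_p` of `{∞}`-integral adeles. -/
noncomputable def integralAdelicPoints (f : IntegralForm infty n) : Subgroup (AdelicPoints f) where
  carrier := {x | ∀ p : FFPrime F K, p ≠ infty → x p ∈ integralLocalPoints f p}
  mul_mem' hx hy p hp := mul_mem (hx p hp) (hy p hp)
  one_mem' p _ := one_mem (integralLocalPoints f p)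
  inv_mem' hx p hp := inv_mem (hx p hp)

/-- The subgroup of `K`-points of the orthogonal group scheme of `f`, diagonally embedded in the
adelic points. (A matrix over `K` is integral at almost all primes, so each `K`-point occurs.) -/
noncomputable def rationalPoints (f : IntegralForm infty n) : Subgroup (AdelicPoints f) where
  carrier := {x | ∃ γ ∈ orthogonalPoints (integersAwayFrom infty).subtype f.1,
    ∀ p : FFPrime F K, ((x p : LocalPoints f p) : GL (Fin n) p.Completion) =
      Matrix.GeneralLinearGroup.map (algebraMap K p.Completion) γ}
  mul_mem' := by
    rintro x y ⟨γ, hγ, hx⟩ ⟨δ, hδ, hy⟩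
    exact ⟨γ * δ, mul_mem hγ hδ, fun p => by
      rw [map_mul, ← hx p, ← hy p]; rfl⟩
  one_mem' := ⟨1, one_mem _, fun p => by rw [map_one]; rfl⟩
  inv_mem' := by
    rintro x ⟨γ, hγ, hx⟩
    exact ⟨γ⁻¹, inv_mem hγ, fun p => by rw [map_inv, ← hx p]; rfl⟩

/-- The class number of the orthogonal group scheme of `f`: the cardinality of its class set
`G(A_∞) \ G(A) / G(K)`. -/
noncomputable def classNumber (f : IntegralForm infty n) : Cardinal :=
  Cardinal.mk (DoubleCoset.Quotient (integralAdelicPoints f : Set (AdelicPoints f))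
    (rationalPoints f : Set (AdelicPoints f)))

end Genus

end FunctionFieldForms

/-! Write A for the Gram matrix of f and O for the ring of {∞}-integers. An adelic point x and a
form g in the genus, with Gram matrix G, are matched (`Corresponds`) when some h in GL_n(K)
satisfies G = hᵗAh and makes u_p = x_p h integral, with integral inverse, at every p ≠ ∞. Given g,
take h from the isomorphism over K and u_p from the local ones, and put x_p = u_p h⁻¹. Given x and
such an h, x_p fixes A, so hᵗAh = u_pᵗAu_p; hence hᵗAh has entries in O and defines a form in the
genus. For two matched pairs, x' = a x γ translates into an isomorphism w = h'⁻¹γ⁻¹h over O between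
the forms, and back (`Corresponds.rel_iff`). So the correspondence induces a bijection between
double cosets and isomorphism classes.

The real content is the existence of h for a given x, i.e. that the O-lattice attached to x is free.
In general the determinant gives an obstruction in the class group of O. Here det A ≠ 0 forces (det
x_p)² = 1, and strong approximation for SL_n away from ∞ does the rest
(`exists_global_mul_mem_integralGL`). As SL_n over a field is generated by transvections, this
reduces to strong approximation for K itself (`exists_strong_approx`), which rests on weak
approximation, the finiteness of the set of poles, the algebraicity of residue fields over the
finite constant field, and an element whose only pole is ∞ (`exists_pole_only`). -/

namespace FunctionFieldForms

open scoped WithZero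

/-! ### Independence of valuations and weak approximation. -/

section Valuations

variable {F K : Type*} [Field F] [Field K] [Algebra F K]

theorem exists_forall_ge_pow_mul_lt {γ : ℤᵐ⁰} (hγ : γ < 1) (δ : ℤᵐ⁰) {ε : ℤᵐ⁰} (hε : ε ≠ 0) :
    ∃ N : ℕ, ∀ n ≥ N, γ ^ n * δ < ε := by
  obtain ⟨N, hN⟩ : ∃ N : ℕ, γ ^ N * δ < ε := by
    rcases eq_or_ne δ 0 with rfl | hδ
    · exact ⟨0, by simpa using zero_lt_iff.2 hε⟩
    · obtain ⟨N, hN⟩ := exists_pow_lt₀ hγ (Units.mk0 (ε / δ) (div_ne_zero hε hδ))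
      exact ⟨N, (lt_div_iff₀ (zero_lt_iff.2 hδ)).1 hN⟩
  refine ⟨N, fun n hn => lt_of_le_of_lt ?_ hN⟩
  gcongr 1
  exact pow_le_pow_right_of_le_one' hγ.le hn

namespace FFPrime

/-- The valuation of `K` attached to a prime. -/
noncomputable abbrev v (p : FFPrime F K) : Valuation K ℤᵐ⁰ :=
  (IsDiscreteValuationRing.maximalIdeal p.valRing).valuation K

theorem v_le_one_iff (p : FFPrime F K) {a : K} : p.v a ≤ 1 ↔ a ∈ p.valRing := by
  constructor
  · intro h
    obtain ⟨b, rfl⟩ := IsDiscreteValuationRing.exists_lift_of_le_one h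
    exact b.2
  · intro h
    exact (IsDiscreteValuationRing.maximalIdeal p.valRing).valuation_le_one (⟨a, h⟩ : p.valRing)

theorem v_algebraMap_le (p : FFPrime F K) (c : F) : p.v (algebraMap F K c) ≤ 1 :=
  p.v_le_one_iff.2 (p.algebraMap_mem c)

theorem v_algebraMap (p : FFPrime F K) {c : F} (hc : c ≠ 0) : p.v (algebraMap F K c) = 1 := by
  refine le_antisymm (p.v_algebraMap_le c) ?_
  have h := p.v_algebraMap_le c⁻¹
  rw [map_inv₀, map_inv₀] at h
  exact (inv_le_one₀ (zero_lt_iff.2 (by simpa using hc))).1 h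

theorem ext_valRing {p q : FFPrime F K} (h : p.valRing = q.valRing) : p = q := by
  cases p; cases q; cases h; rfl

theorem exists_one_lt_v (p : FFPrime F K) : ∃ a, 1 < p.v a := by
  obtain ⟨a, ha⟩ := (IsDiscreteValuationRing.maximalIdeal p.valRing).valuation_surjective K
    (WithZero.exp 1)
  exact ⟨a, by rw [ha]; decide⟩

/-- Discrete valuation rings of K are maximal subrings. Were the ring of `p` inside that of `q`,
with `a` integral at `q` but not at `p`, then for any `z` some `a⁻¹ ^ N * z` would be integral at
`p`, hence at `q`; multiplying back by `a ^ N` would make every `z` integral at `q`. -/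
theorem exists_le_one_one_lt {p q : FFPrime F K} (h : p ≠ q) : ∃ a, p.v a ≤ 1 ∧ 1 < q.v a := by
  by_contra! H
  refine h (ext_valRing (le_antisymm (fun a ha => q.v_le_one_iff.1 (H a (p.v_le_one_iff.2 ha))) ?_))
  intro a ha
  by_contra hap
  rw [← v_le_one_iff, not_le] at hap
  have ha0 : a ≠ 0 := by rintro rfl; simp at hap
  obtain ⟨z, hz⟩ := q.exists_one_lt_v
  obtain ⟨N, hN⟩ := exists_forall_ge_pow_mul_lt (inv_lt_one_of_one_lt₀ hap) (p.v z) one_ne_zero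
  have h1 := H (a⁻¹ ^ N * z) (by simpa using (hN N le_rfl).le)
  have h2 : q.v z = q.v a ^ N * q.v (a⁻¹ ^ N * z) := by
    rw [← map_pow, ← map_mul, ← mul_assoc, ← mul_pow, mul_inv_cancel₀ ha0, one_pow, one_mul]
  refine hz.not_ge ?_
  rw [h2]
  exact mul_le_one' (pow_le_one' (q.v_le_one_iff.2 ha) _) h1

theorem exists_one_lt_lt_one {p q : FFPrime F K} (h : p ≠ q) : ∃ a, 1 < p.v a ∧ q.v a < 1 := by
  obtain ⟨c, hc, hc'⟩ := exists_le_one_one_lt h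
  obtain ⟨b, hb, hb'⟩ := exists_le_one_one_lt h.symm
  have hc0 : c ≠ 0 := by rintro rfl; simp at hc'
  refine ⟨b / c, ?_, ?_⟩
  · rw [map_div₀, one_lt_div₀ (zero_lt_iff.2 (by simpa using hc0))]
    exact hc.trans_lt hb'
  · rw [map_div₀, div_lt_one₀ (zero_lt_iff.2 (by simpa using hc0))]
    exact hb.trans_lt hc'

theorem v_one_add_of_one_lt (p : FFPrime F K) {a : K} (h : 1 < p.v a) : p.v (1 + a) = p.v a :=
  p.v.map_add_eq_of_lt_right (by simpa using h)

theorem v_one_add_of_lt_one (p : FFPrime F K) {a : K} (h : p.v a < 1) : p.v (1 + a) = 1 :=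
  p.v.map_one_add_of_lt h

/-- Artin–Whaples induction. With `a` good for `S` and `b` separating `p` from the new prime `q`,
the product `a ^ N * b` works if `a` is integral at `q`. If `a` has a pole there, the power is
replaced by `a ^ m / (1 + a ^ m)`, which has value 1 at `p` and `q` and is small on `S`. -/
theorem exists_one_lt_forall_lt_one (p : FFPrime F K) (S : Finset (FFPrime F K)) (hp : p ∉ S) :
    ∃ a, 1 < p.v a ∧ ∀ q ∈ S, q.v a < 1 := by
  classical
  induction S using Finset.induction_on with
  | empty => simpa using p.exists_one_lt_v
  | insert q S hq ih =>
    rw [Finset.mem_insert, not_or] at hp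
    obtain ⟨a, ha, haS⟩ := ih hp.2
    obtain ⟨b, hb, hbq⟩ := exists_one_lt_lt_one hp.1
    have key : ∃ N : ℕ, ∀ s ∈ S, ∀ n ≥ N, s.v a ^ n * s.v b < 1 := by
      have : ∀ s : FFPrime F K, ∃ N : ℕ, s ∈ S → ∀ n ≥ N, s.v a ^ n * s.v b < 1 := by
        intro s
        by_cases hs : s ∈ S
        · obtain ⟨N, hN⟩ := exists_forall_ge_pow_mul_lt (haS s hs) (s.v b) one_ne_zero
          exact ⟨N, fun _ => hN⟩
        · exact ⟨0, fun h => absurd h hs⟩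
      choose N hN using this
      exact ⟨S.sup N, fun s hs n hn => hN s hs n ((Finset.le_sup hs).trans hn)⟩
    obtain ⟨N, hN⟩ := key
    rcases le_or_gt (q.v a) 1 with h | h
    · refine ⟨a ^ N * b, ?_, ?_⟩
      · rw [map_mul, map_pow]
        exact hb.trans_le (le_mul_of_one_le_left' (one_le_pow₀ ha.le))
      · intro s hs
        rw [map_mul, map_pow]
        rcases Finset.mem_insert.1 hs with rfl | hs
        · exact (mul_le_of_le_one_left' (pow_le_one' h _)).trans_lt hbq
        · exact hN s hs N le_rfl
    · have hpow : ∀ s : FFPrime F K, 1 < s.v a → 1 < s.v (a ^ (N + 1)) := fun s hs => by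
        rw [map_pow]; exact one_lt_pow₀ hs (Nat.succ_ne_zero _)
      have hbig : ∀ s : FFPrime F K, 1 < s.v a → s.v (a ^ (N + 1) / (1 + a ^ (N + 1)) * b) = s.v b := by
        intro s hs
        rw [map_mul, map_div₀, v_one_add_of_one_lt _ (hpow s hs), div_self, one_mul]
        exact (zero_lt_one.trans (hpow s hs)).ne'
      refine ⟨a ^ (N + 1) / (1 + a ^ (N + 1)) * b, by rwa [hbig p ha], ?_⟩
      intro s hs
      rcases Finset.mem_insert.1 hs with rfl | hs
      · rwa [hbig _ h]
      · have h1 : s.v (a ^ (N + 1)) < 1 := by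
          rw [map_pow]; exact pow_lt_one₀ zero_le (haS s hs) (Nat.succ_ne_zero _)
        rw [map_mul, map_div₀, v_one_add_of_lt_one _ h1, div_one, map_pow]
        exact hN s hs _ (Nat.le_succ N)

/-- Weak approximation. -/
theorem exists_approx_one (p : FFPrime F K) (S : Finset (FFPrime F K)) (hp : p ∉ S)
    {ε : ℤᵐ⁰} (hε : ε ≠ 0) : ∃ e, p.v (e - 1) < ε ∧ ∀ q ∈ S, q.v e < ε := by
  classical
  obtain ⟨a, ha, haS⟩ := p.exists_one_lt_forall_lt_one S hp
  have ha0 : a ≠ 0 := by rintro rfl; simp at ha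
  obtain ⟨N₀, hN₀⟩ := exists_forall_ge_pow_mul_lt (inv_lt_one_of_one_lt₀ ha) 1 hε
  have : ∀ s : FFPrime F K, ∃ N : ℕ, s ∈ S → ∀ n ≥ N, s.v a ^ n * 1 < ε := by
    intro s
    by_cases hs : s ∈ S
    · obtain ⟨N, hN⟩ := exists_forall_ge_pow_mul_lt (haS s hs) 1 hε
      exact ⟨N, fun _ => hN⟩
    · exact ⟨0, fun h => absurd h hs⟩
  choose N hN using this
  set n := max N₀ (S.sup N) + 1 with hn
  have hpow : 1 < p.v (a ^ n) := by
    rw [map_pow]; exact one_lt_pow₀ ha (Nat.succ_ne_zero _)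
  have hne : 1 + a ^ n ≠ 0 := by
    intro h
    have := p.v_one_add_of_one_lt hpow
    rw [h, map_zero] at this
    rw [← this] at hpow
    exact not_lt_zero hpow
  -- As `n` grows, this tends to 1 where `a` has a pole and to 0 where `a` has a zero.
  refine ⟨a ^ n / (1 + a ^ n), ?_, fun s hs => ?_⟩
  · have : a ^ n / (1 + a ^ n) - 1 = - (1 + a ^ n)⁻¹ := by field_simp; ring
    rw [this, Valuation.map_neg, map_inv₀, v_one_add_of_one_lt _ hpow, map_pow, ← inv_pow]
    simpa using hN₀ n (by omega)
  · have h1 : s.v (a ^ n) < 1 := by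
      rw [map_pow]; exact pow_lt_one₀ zero_le (haS s hs) (Nat.succ_ne_zero _)
    rw [map_div₀, v_one_add_of_lt_one _ h1, div_one, map_pow]
    have : S.sup N ≤ n := by omega
    simpa using hN s hs n ((Finset.le_sup hs).trans this)

end FFPrime

end Valuations

/-! ### Residue fields and finiteness of the set of poles. -/

section FunctionField

open Polynomial

variable {F K : Type*} [Field F] [Field K] [Algebra F K]

namespace FFPrime

instance isTrivialOn_v (p : FFPrime F K) : p.v.IsTrivialOn F :=
  ⟨fun _ hc => p.v_algebraMap hc⟩

theorem v_aeval_le_one (p : FFPrime F K) {x : K} (hx : p.v x ≤ 1) (g : F[X]) :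
    p.v (aeval x g) ≤ 1 := by
  rw [aeval_eq_sum_range]
  refine Valuation.map_sum_le _ fun i _ => ?_
  rw [Algebra.smul_def, map_mul, map_pow]
  exact mul_le_one' (p.v_algebraMap_le _) (pow_le_one' hx _)

theorem mem_valRing_of_isIntegral (p : FFPrime F K) {A : Subalgebra F K}
    (hA : ∀ a ∈ A, p.v a ≤ 1) {y : K} (hy : IsIntegral A y) : p.v y ≤ 1 := by
  let φ : A →+* p.valRing :=
    A.val.toRingHom.codRestrict p.valRing.toSubring fun a => p.v_le_one_iff.1 (hA _ a.2)
  have h : IsIntegral p.valRing y := hy.map_of_comp_eq φ (RingHom.id K) rfl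
  obtain ⟨z, rfl⟩ := IsIntegrallyClosed.algebraMap_eq_of_integral h
  exact p.v_le_one_iff.2 z.2

theorem transcendental (p : FFPrime F K) {x : K} (hx : x ≠ 0) (h : p.v x ≠ 1) :
    Transcendental F x :=
  p.v.transcendental_of_ne_one F x hx h

end FFPrime

namespace IsCurveFunctionField

variable (hK : IsCurveFunctionField F K)
include hK

theorem isTranscendenceBasis {x : K} (hx : Transcendental F x) :
    IsTranscendenceBasis F (fun _ : Unit => x) := by
  refine ((algebraicIndependent_unique_type_iff (ι := Unit)).2 hx).isTranscendenceBasis_of_lift_trdeg_le_of_finite ?_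
  simp [hK.trdeg_eq_one]

theorem isAlgebraic_adjoin {x : K} (hx : Transcendental F x) :
    Algebra.IsAlgebraic (Algebra.adjoin F {x}) K := by
  have := (hK.isTranscendenceBasis hx).isAlgebraic
  rwa [Set.range_const] at this

theorem finiteDimensional {x : K} (hx : Transcendental F x) :
    FiniteDimensional (IntermediateField.adjoin F {x}) K := by
  have h := (hK.isTranscendenceBasis hx).isAlgebraic_field
  rw [Set.range_const] at h
  have := hK.essFiniteType
  have := Algebra.EssFiniteType.of_comp F (IntermediateField.adjoin F {x}) K
  exact Algebra.finite_of_essFiniteType_of_isAlgebraic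

/-- The residue field is algebraic over F. Otherwise `u` is transcendental and every nonzero element
of F[u] has value at least 1. As K is algebraic over F[u], an element `z` with a pole has a multiple
`c * z` integral over F[u], hence integral at `p`; since `c` has value at least 1, so is `z`. -/
theorem exists_aeval_lt_one (p : FFPrime F K) {u : K} (hu : p.v u ≤ 1) :
    ∃ g : F[X], g ≠ 0 ∧ p.v (aeval u g) < 1 := by
  by_cases hut : Transcendental F u
  · by_contra! H
    obtain ⟨z, hz⟩ := p.exists_one_lt_v
    have := hK.isAlgebraic_adjoin hut
    obtain ⟨c, hc, hcz⟩ := (Algebra.IsAlgebraic.isAlgebraic (R := Algebra.adjoin F {u}) z).exists_integral_multiple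
    have hA : ∀ a ∈ Algebra.adjoin F {u}, p.v a ≤ 1 := by
      intro a ha
      rw [Algebra.adjoin_singleton_eq_range_aeval] at ha
      obtain ⟨g, rfl⟩ := ha
      exact p.v_aeval_le_one hu g
    have h1 := p.mem_valRing_of_isIntegral hA hcz
    obtain ⟨g, hg⟩ : ∃ g : F[X], aeval u g = (c : K) := by
      exact Algebra.adjoin_mem_exists_aeval F u c.2
    have hg0 : g ≠ 0 := by
      rintro rfl
      exact hc (Subtype.ext (by simpa using hg.symm))
    have h2 : (1 : ℤᵐ⁰) ≤ p.v (c : K) := hg ▸ H g hg0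
    rw [Algebra.smul_def, map_mul] at h1
    exact hz.not_ge ((le_mul_of_one_le_left' h2).trans h1)
  · rw [Transcendental, not_not] at hut
    obtain ⟨g, hg, h⟩ := hut
    exact ⟨g, hg, by simp [h]⟩

/-- The residue of `u` is a root of a nonzero polynomial `g`, and F[X]/(g) is finite, so two powers
of X agree there; the lower one is cancelled because `u` is a unit at `p`. -/
theorem exists_pow_sub_one_lt_one [Finite F] (p : FFPrime F K) {u : K} (hu : p.v u = 1) :
    ∃ m : ℕ, 0 < m ∧ p.v (u ^ m - 1) < 1 := by
  obtain ⟨g, hg, hgu⟩ := hK.exists_aeval_lt_one p hu.le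
  have := (AdjoinRoot.powerBasis hg).finite
  have : Finite (AdjoinRoot g) := Module.finite_of_finite F
  obtain ⟨i, j, hij, h⟩ := Finite.exists_ne_map_eq_of_infinite (fun n : ℕ => AdjoinRoot.mk g (X ^ n))
  wlog hlt : j < i generalizing i j
  · exact this j i hij.symm h.symm (by omega)
  obtain ⟨k, hk⟩ := AdjoinRoot.mk_eq_mk.1 h
  refine ⟨i - j, by omega, ?_⟩
  have h1 : u ^ j * (u ^ (i - j) - 1) = aeval u g * aeval u k := by
    rw [mul_sub, ← pow_add, show j + (i - j) = i by omega, ← map_mul, ← hk]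
    simp
  have h2 := congrArg p.v h1
  rw [map_mul, map_pow, hu, one_pow, one_mul, map_mul] at h2
  rw [h2]
  exact (mul_le_of_le_one_right' (p.v_aeval_le_one hu.le k)).trans_lt hgu

/-- An element has only finitely many poles. -/
theorem finite_setOf_one_lt (a : K) : {p : FFPrime F K | 1 < p.v a}.Finite := by
  classical
  by_contra hinf
  rw [← Set.Infinite] at hinf
  obtain ⟨p₀, hp₀⟩ := hinf.nonempty
  have ha0 : a ≠ 0 := by rintro rfl; simp at hp₀
  have := hK.finiteDimensional (p₀.transcendental ha0 (ne_of_gt hp₀))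
  set E := IntermediateField.adjoin F {a}
  -- One pole more than the degree of K over F(a). The elements `y p`, near 1 at `p` and small at
  -- the other poles in `S`, will turn out to be independent over F(a), a contradiction.
  obtain ⟨S, hS, hcard⟩ := hinf.exists_subset_card_eq (Module.finrank E K + 1)
  choose y hy hyS using fun p : FFPrime F K =>
    p.exists_approx_one (S.erase p) (Finset.notMem_erase p S) one_ne_zero
  have hy1 : ∀ p : FFPrime F K, p.v (y p) = 1 := fun p => by
    simpa using p.v.map_one_add_of_lt (hy p)
  -- At a pole of `a` the value of a rational function of `a` depends only on the degrees of
  -- numerator and denominator. Hence all these poles agree on which elements of F(a) are integral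
  -- (`hle`).
  have hE : ∀ c : E, c ≠ 0 → ∃ k l : ℕ, ∀ p ∈ S, p.v (c : K) = p.v a ^ k / p.v a ^ l := by
    intro c hc
    obtain ⟨r, s, hrs⟩ := (IntermediateField.mem_adjoin_simple_iff F _).1 c.2
    have hr : r ≠ 0 := by
      rintro rfl; exact hc (Subtype.ext (by simpa using hrs))
    have hs : s ≠ 0 := by
      rintro rfl; exact hc (Subtype.ext (by simpa using hrs))
    refine ⟨r.natDegree, s.natDegree, fun p hp => ?_⟩
    rw [hrs, map_div₀,
      valuation_aeval_eq_valuation_X_pow_natDegree_of_one_lt_valuation_X _ (hS hp) hr,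
      valuation_aeval_eq_valuation_X_pow_natDegree_of_one_lt_valuation_X _ (hS hp) hs]
  have hle : ∀ c : E, ∀ p ∈ S, ∀ q ∈ S, p.v (c : K) ≤ 1 → q.v (c : K) ≤ 1 := by
    intro c p hp q hq h
    rcases eq_or_ne c 0 with rfl | hc
    · simp
    · obtain ⟨k, l, hkl⟩ := hE c hc
      have hpa : 1 < p.v a := hS hp
      have hqa : 1 < q.v a := hS hq
      rw [hkl p hp, div_le_one₀ (pow_pos (zero_lt_one.trans hpa) _),
        pow_le_pow_iff_right₀ hpa] at h
      rw [hkl q hq, div_le_one₀ (pow_pos (zero_lt_one.trans hqa) _)]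
      exact pow_le_pow_right₀ hqa.le h
  have hli : LinearIndependent E (fun p : S => y p) := by
    rw [Fintype.linearIndependent_iff]
    intro c hc
    by_contra! hne
    obtain ⟨i₀, hi₀⟩ := hne
    -- The largest coefficient is chosen by its value at `i₀`; `hle` carries the comparison over to
    -- the prime `j`. After division by `c j`, the `j`-th term has value 1 at `j` and all others
    -- less.
    obtain ⟨j, -, hj⟩ := Finset.exists_max_image (Finset.univ : Finset S)
      (fun i => (i₀ : FFPrime F K).v (c i : K)) ⟨i₀, Finset.mem_univ _⟩
    have hcj : c j ≠ 0 := by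
      intro h
      have := hj i₀ (Finset.mem_univ _)
      rw [h] at this
      simp at this
      exact hi₀ this
    have hint : ∀ i : S, (j : FFPrime F K).v ((c i / c j : E) : K) ≤ 1 := by
      intro i
      refine hle _ i₀ i₀.2 j j.2 ?_
      push_cast
      rw [map_div₀, div_le_one₀ (zero_lt_iff.2 (by simpa using hcj))]
      exact hj i (Finset.mem_univ _)
    have hsum : ∑ i : S, ((c i / c j : E) : K) * y i = 0 := by
      have : ∑ i : S, ((c i / c j : E) : K) * y i = ((c j)⁻¹ : E) * ∑ i : S, c i • y i := by
        rw [Finset.mul_sum]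
        refine Finset.sum_congr rfl fun i _ => ?_
        rw [Algebra.smul_def]
        simp only [IntermediateField.algebraMap_apply]
        push_cast
        ring
      rw [this, hc, mul_zero]
    rw [← Finset.add_sum_erase _ _ (Finset.mem_univ j), div_self hcj] at hsum
    have hlt : (j : FFPrime F K).v (∑ i ∈ Finset.univ.erase j, ((c i / c j : E) : K) * y i) < 1 := by
      refine Valuation.map_sum_lt _ one_ne_zero fun i hi => ?_
      rw [map_mul]
      refine (mul_le_of_le_one_left' (hint i)).trans_lt (hyS i j ?_)
      exact Finset.mem_erase.2 ⟨fun h => (Finset.mem_erase.1 hi).1 (Subtype.ext h).symm, j.2⟩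
    have := congrArg (j : FFPrime F K).v (eq_neg_of_add_eq_zero_left hsum)
    rw [Valuation.map_neg] at this
    rw [← this] at hlt
    simp [hy1] at hlt
  have := hli.fintype_card_le_finrank
  simp [hcard] at this

end IsCurveFunctionField

end FunctionField

/-! ### Riemann-type finiteness and strong approximation for K. -/

section StrongApproximation

open Polynomial

variable {F K : Type*} [Field F] [Field K] [Algebra F K]

/-- The elements of `K` which are integral at all primes in `S`, as an `F`-subspace. -/
def integralAt (S : Set (FFPrime F K)) : Submodule F K where
  carrier := {a | ∀ p ∈ S, p.v a ≤ 1}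
  add_mem' ha hb p hp := Valuation.map_add_le _ (ha p hp) (hb p hp)
  zero_mem' p _ := by simp
  smul_mem' c a ha p hp := by
    rw [Algebra.smul_def, map_mul]
    exact mul_le_one' (p.v_algebraMap_le c) (ha p hp)

theorem exists_forall_ge_forall_mem {ι : Type*} (S : Finset ι) {P : ι → ℕ → Prop}
    (h : ∀ i ∈ S, ∃ N, ∀ n ≥ N, P i n) : ∃ N, ∀ i ∈ S, ∀ n ≥ N, P i n := by
  choose! N hN using h
  exact ⟨S.sup N, fun i hi n hn => hN i hi n ((Finset.le_sup hi).trans hn)⟩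

namespace IsCurveFunctionField

variable (hK : IsCurveFunctionField F K)
include hK

/-- Elements spanning `K` over `F(x)` which are integral wherever `x` is. -/
theorem exists_integral_spanning {x : K} (hx : Transcendental F x) :
    ∃ (d : ℕ) (w : Fin d → K), (∀ i, ∀ p : FFPrime F K, p.v x ≤ 1 → p.v (w i) ≤ 1) ∧
      ∀ z : K, ∃ c : Fin d → IntermediateField.adjoin F {x}, z = ∑ i, (c i : K) * w i := by
  classical
  have := hK.finiteDimensional hx
  have := hK.isAlgebraic_adjoin hx
  let b := Module.finBasis (IntermediateField.adjoin F {x}) K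
  obtain ⟨c, hc, hint⟩ := Algebra.IsAlgebraic.exists_integral_multiples (Algebra.adjoin F {x})
    (Finset.univ.image b)
  refine ⟨_, fun i => c • b i, fun i p hp => ?_, fun z => ?_⟩
  · refine p.mem_valRing_of_isIntegral (fun a ha => ?_) (hint (b i) (by simp))
    obtain ⟨g, rfl⟩ := Algebra.adjoin_mem_exists_aeval F x ha
    exact p.v_aeval_le_one hp g
  · refine ⟨fun i => b.repr (z / c) i, ?_⟩
    have h := b.sum_repr (z / c)
    have hc' : (c : K) ≠ 0 := fun h => hc (Subtype.ext h)
    calc z = (∑ i, (b.repr (z / c) i) • b i) * c := by rw [h]; field_simp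
      _ = _ := by
        rw [Finset.sum_mul]
        refine Finset.sum_congr rfl fun i _ => ?_
        rw [Algebra.smul_def, mul_assoc, mul_comm (b i)]
        rfl

/-- Let `T` be the set of poles of `x`. Then the sum of the elements integral outside `T` and of
the elements integral in `T` has finite codimension in `K`. -/
theorem finite_quotient_integralAt {x : K} (hx : Transcendental F x) :
    Module.Finite F (K ⧸ (integralAt {p : FFPrime F K | 1 < p.v x}ᶜ ⊔
      integralAt {p : FFPrime F K | 1 < p.v x})) := by
  classical
  set T := {p : FFPrime F K | 1 < p.v x} with hT
  have hTfin : T.Finite := hK.finite_setOf_one_lt x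
  have hx0 : x ≠ 0 := by rintro rfl; exact hx isAlgebraic_zero
  obtain ⟨d, w, hw, hspan⟩ := hK.exists_integral_spanning hx
  obtain ⟨N, hN⟩ : ∃ N : ℕ, ∀ p ∈ T, ∀ i, p.v (x⁻¹ ^ N * w i) ≤ 1 := by
    obtain ⟨N, hN⟩ := exists_forall_ge_forall_mem
      (hTfin.toFinset ×ˢ (Finset.univ : Finset (Fin d)))
      (P := fun pi n => pi.1.v (x⁻¹ ^ n * w pi.2) ≤ 1) (fun pi hpi => by
        have hp : 1 < pi.1.v x := by simpa [hT] using hpi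
        obtain ⟨N, hN⟩ := exists_forall_ge_pow_mul_lt (inv_lt_one_of_one_lt₀ hp) (pi.1.v (w pi.2))
          one_ne_zero
        exact ⟨N, fun n hn => by simpa using (hN n hn).le⟩)
    exact ⟨N, fun p hp i => hN (p, i) (by simpa using hp) N le_rfl⟩
  set B := integralAt Tᶜ
  set O := integralAt T
  -- The finitely many `x⁻¹ ^ k * w i` with `k ≤ N` span a complement up to overlap: below, `B`, `O`
  -- and `W` together give all of K.
  set W : Submodule F K := Submodule.span F
    (Set.range fun ji : Fin (N + 1) × Fin d => x⁻¹ ^ (ji.1 : ℕ) * w ji.2)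
  have hWfin : FiniteDimensional F W := FiniteDimensional.span_of_finite F (Set.finite_range _)
  have hxB : ∀ (k : ℕ) i, x ^ k * w i ∈ B := by
    intro k i p hp
    have hp' : p.v x ≤ 1 := not_lt.1 hp
    rw [map_mul, map_pow]
    exact mul_le_one' (pow_le_one' hp' _) (hw i p hp')
  have hpoly : ∀ (q : F[X]) i, aeval x q * (x⁻¹ ^ N * w i) ∈ B ⊔ O ⊔ W := by
    intro q i
    rw [aeval_eq_sum_range, Finset.sum_mul]
    refine Submodule.sum_mem _ fun k _ => ?_
    rw [smul_mul_assoc]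
    refine Submodule.smul_mem _ _ ?_
    rcases le_total N k with h | h
    · have : x ^ k * (x⁻¹ ^ N * w i) = x ^ (k - N) * w i := by
        rw [← mul_assoc, pow_sub₀ x hx0 h, inv_pow]
      rw [this]
      exact Submodule.mem_sup_left (Submodule.mem_sup_left (hxB _ _))
    · have : x ^ k * (x⁻¹ ^ N * w i) = x⁻¹ ^ (N - k) * w i := by
        rw [← mul_assoc, pow_sub₀ _ (inv_ne_zero hx0) h, inv_pow, inv_pow, inv_inv, mul_comm (x ^ k)]
      rw [this]
      exact Submodule.mem_sup_right
        (Submodule.subset_span ⟨(⟨N - k, by omega⟩, i), rfl⟩)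
  have htop : ∀ z, z ∈ B ⊔ O ⊔ W := by
    intro z
    obtain ⟨c, rfl⟩ := hspan z
    refine Submodule.sum_mem _ fun i _ => ?_
    obtain ⟨r, s, hrs⟩ := (IntermediateField.mem_adjoin_simple_iff F _).1 (c i).2
    rw [hrs]
    rcases eq_or_ne s 0 with rfl | hs
    · simp
    have hs' : aeval x s ≠ 0 := fun h => hx ⟨s, hs, h⟩
    -- Dividing `r * X ^ N` by `s` splits (r/s) w_i into a polynomial in `x` times `x⁻¹ ^ N * w i`
    -- and a remainder. The remainder is integral on `T`: `m / s` has degree below zero and `N`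
    -- makes `x⁻¹ ^ N * w i` integral there.
    have hdiv := EuclideanDomain.div_add_mod (r * X ^ N) s
    have hdeg : ((r * X ^ N) % s).degree < s.degree := EuclideanDomain.mod_lt _ hs
    set q := (r * X ^ N) / s
    set m := (r * X ^ N) % s
    have hEq : aeval x r / aeval x s * w i =
        aeval x q * (x⁻¹ ^ N * w i) + aeval x m / aeval x s * (x⁻¹ ^ N * w i) := by
      have := congrArg (aeval x) hdiv
      simp only [map_add, map_mul, map_pow, aeval_X] at this
      have h2 : aeval x r = (aeval x s * aeval x q + aeval x m) * x⁻¹ ^ N := by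
        rw [this, mul_assoc, ← mul_pow, mul_inv_cancel₀ hx0, one_pow, mul_one]
      rw [h2]
      field_simp
    rw [hEq]
    refine Submodule.add_mem _ (hpoly q i) (Submodule.mem_sup_left (Submodule.mem_sup_right ?_))
    intro p hp
    rw [map_mul]
    refine mul_le_one' ?_ (hN p hp i)
    rcases eq_or_ne m 0 with hm | hm
    · simp [hm]
    have hp' : 1 < p.v x := hp
    rw [map_div₀, valuation_aeval_eq_valuation_X_pow_natDegree_of_one_lt_valuation_X _ hp' hm,
      valuation_aeval_eq_valuation_X_pow_natDegree_of_one_lt_valuation_X _ hp' hs,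
      div_le_one₀ (pow_pos (zero_lt_one.trans hp') _)]
    exact pow_le_pow_right₀ hp'.le (natDegree_le_natDegree hdeg.le)
  refine Module.Finite.of_surjective ((B ⊔ O).mkQ.comp W.subtype) fun z => ?_
  obtain ⟨z, rfl⟩ := Submodule.mkQ_surjective _ z
  obtain ⟨y, hy, u, hu, rfl⟩ := Submodule.mem_sup.1 (htop z)
  refine ⟨⟨u, hu⟩, ?_⟩
  simp only [LinearMap.comp_apply, Submodule.subtype_apply, map_add]
  rw [right_eq_add]
  simpa using hy

/-- There is an element whose only pole is a given prime. -/
theorem exists_pole_only [Finite F] (infty : FFPrime F K) :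
    ∃ b : K, 1 < infty.v b ∧ ∀ p ≠ infty, p.v b ≤ 1 := by
  classical
  obtain ⟨x, hx⟩ := infty.exists_one_lt_v
  have hx0 : x ≠ 0 := by rintro rfl; simp at hx
  have hxt := infty.transcendental hx0 hx.ne'
  have hTfin : {p : FFPrime F K | 1 < p.v x}.Finite := hK.finite_setOf_one_lt x
  have := hK.finite_quotient_integralAt hxt
  set T := {p : FFPrime F K | 1 < p.v x}
  have : Finite (K ⧸ (integralAt Tᶜ ⊔ integralAt T)) := Module.finite_of_finite F
  obtain ⟨z, hz, hzT⟩ := infty.exists_one_lt_forall_lt_one (hTfin.toFinset.erase infty)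
    (Finset.notMem_erase _ _)
  -- Pigeonhole in a finite quotient: `z ^ i - z ^ j = b + o` with `b` integral outside `T` and `o`
  -- integral on `T`. Within `T`, subtracting `o` leaves the pole of `z ^ i` at `infty` and creates
  -- no other.
  obtain ⟨i, j, hij, h⟩ := Finite.exists_ne_map_eq_of_infinite
    (fun n : ℕ => (integralAt Tᶜ ⊔ integralAt T).mkQ (z ^ n))
  wlog hlt : j < i generalizing i j
  · exact this j i hij.symm h.symm (by omega)
  rw [Submodule.mkQ_apply, Submodule.mkQ_apply, Submodule.Quotient.eq] at h
  obtain ⟨b, hb, o, ho, hbo⟩ := Submodule.mem_sup.1 h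
  have hb' : b = (z ^ i - z ^ j) - o := by rw [← hbo]; ring
  have hinf : infty.v (z ^ i - z ^ j) = infty.v z ^ i := by
    rw [← map_pow]
    refine Valuation.map_sub_eq_of_lt_left _ ?_
    rw [map_pow, map_pow]
    exact pow_lt_pow_right₀ hz hlt
  have hzi : 1 < infty.v z ^ i := one_lt_pow₀ hz (by omega)
  refine ⟨b, ?_, fun p hp => ?_⟩
  · rw [hb', Valuation.map_sub_eq_of_lt_left, hinf]
    · exact hzi
    · rw [hinf]
      exact (ho infty hx).trans_lt hzi
  · by_cases hpT : p ∈ T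
    · have hzp : p.v z ≤ 1 := (hzT p (by simp [hp, hpT])).le
      rw [hb']
      refine p.v.map_sub_le (p.v.map_sub_le ?_ ?_) (ho p hpT) <;>
      · rw [map_pow]; exact pow_le_one' hzp _
    · exact hb p hpT

/-- There is a nonzero element with no pole outside `infty` and a zero at a given prime. -/
theorem exists_zero_pole_only [Finite F] {infty p : FFPrime F K} (hp : p ≠ infty) :
    ∃ w : K, w ≠ 0 ∧ p.v w < 1 ∧ ∀ q ≠ infty, q.v w ≤ 1 := by
  obtain ⟨b, hb, hb'⟩ := hK.exists_pole_only infty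
  rcases (hb' p hp).lt_or_eq with h | h
  · exact ⟨b, by rintro rfl; simp at hb, h, hb'⟩
  · obtain ⟨m, hm, hm'⟩ := hK.exists_pow_sub_one_lt_one p h
    refine ⟨b ^ m - 1, fun h0 => ?_, hm', fun q hq => ?_⟩
    · have := one_lt_pow₀ hb hm.ne'
      rw [← map_pow, sub_eq_zero.1 h0, map_one] at this
      exact lt_irrefl _ this
    · refine q.v.map_sub_le ?_ q.v.map_one.le
      rw [map_pow]
      exact pow_le_one' (hb' q hq) _

/-- Strong approximation: elements of `K` can be approximated at a prime `p ≠ infty` by elements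
which are integral at all primes except `p` and `infty`. -/
theorem exists_strong_approx [Finite F] {infty p : FFPrime F K} (hp : p ≠ infty) (a : K)
    {ε : ℤᵐ⁰} (hε : ε ≠ 0) :
    ∃ r : K, p.v (r - a) < ε ∧ ∀ q, q ≠ p → q ≠ infty → q.v r ≤ 1 := by
  classical
  rcases eq_or_ne a 0 with rfl | ha0
  · exact ⟨0, by simpa using zero_lt_iff.2 hε, by simp⟩
  obtain ⟨w, hw0, hwp, hw⟩ := hK.exists_zero_pole_only hp
  have hS₀ : {q : FFPrime F K | 1 < q.v w⁻¹}.Finite := hK.finite_setOf_one_lt _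
  set S := hS₀.toFinset.erase p with hS
  obtain ⟨δ, hδ, hδp, hδS⟩ : ∃ δ : ℤᵐ⁰, δ ≠ 0 ∧ δ * p.v a ≤ ε ∧ ∀ q ∈ S, δ * q.v a ≤ 1 := by
    obtain ⟨γ, hγ0, hγ⟩ : ∃ γ : ℤᵐ⁰, γ ≠ 0 ∧ γ < 1 := ⟨WithZero.exp (-1), by simp, by decide⟩
    obtain ⟨N, hN⟩ := exists_forall_ge_pow_mul_lt hγ (p.v a) hε
    obtain ⟨M, hM⟩ := exists_forall_ge_forall_mem S (P := fun q n => γ ^ n * q.v a ≤ 1)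
      fun q _ => by
        obtain ⟨N, hN⟩ := exists_forall_ge_pow_mul_lt hγ (q.v a) one_ne_zero
        exact ⟨N, fun n hn => (hN n hn).le⟩
    exact ⟨γ ^ max N M, pow_ne_zero _ hγ0, (hN _ (le_max_left _ _)).le,
      fun q hq => hM q hq _ (le_max_right _ _)⟩
  -- `a * e` stays close to `a` at `p` and is integral at the other zeros of `w`. So `w` is a unit
  -- at each remaining bad pole, i.e. on `P`.
  obtain ⟨e, hep, heS⟩ := p.exists_approx_one S (Finset.notMem_erase _ _) hδ
  have hap : p.v (a * e - a) < ε := by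
    rw [show a * e - a = (e - 1) * a by ring, map_mul]
    refine lt_of_lt_of_le ?_ hδp
    exact mul_lt_mul_of_pos_right hep (zero_lt_iff.2 (by simpa using ha0))
  have haS : ∀ q ∈ S, q.v (a * e) ≤ 1 := fun q hq => by
    rw [map_mul, mul_comm]
    exact (mul_le_mul_left (heS q hq).le _).trans (hδS q hq)
  have hP₀ : {q : FFPrime F K | 1 < q.v (a * e)}.Finite := hK.finite_setOf_one_lt _
  set P := (hP₀.toFinset.erase p).erase infty with hP
  have hPw : ∀ q ∈ P, q.v w = 1 := by
    intro q hq
    simp only [hP, Finset.mem_erase, Set.Finite.mem_toFinset, Set.mem_ofPred_eq] at hq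
    refine le_antisymm (hw q hq.1) (not_lt.1 fun hlt => ?_)
    refine hq.2.2.not_ge (haS q ?_)
    simp only [hS, Finset.mem_erase, Set.Finite.mem_toFinset, Set.mem_ofPred_eq]
    refine ⟨hq.2.1, ?_⟩
    rw [map_inv₀]
    exact (one_lt_inv₀ (zero_lt_iff.2 (by simpa using hw0))).2 hlt
  have hm : ∀ q ∈ P, ∃ m : ℕ, 0 < m ∧ q.v (w ^ m - 1) < 1 := fun q hq =>
    hK.exists_pow_sub_one_lt_one q (hPw q hq)
  choose! m hm0 hm using hm
  obtain ⟨N, hN⟩ := exists_forall_ge_pow_mul_lt hwp (p.v (a * e)) hε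
  -- Being a multiple of each `m q`, this exponent gives `w ^ M` residue 1 on `P`; being at least
  -- `N`, it makes `w ^ M` small at `p`. Thus `1 - w ^ M` vanishes on `P` and is near 1 at `p`.
  set M := (N + 1) * ∏ q ∈ P, m q with hM
  have hprod : 0 < ∏ q ∈ P, m q := Finset.prod_pos hm0
  have hNM : N ≤ M := by rw [hM]; nlinarith
  have hMw : ∀ q : FFPrime F K, q ≠ infty → q.v (w ^ M) ≤ 1 := fun q hq => by
    rw [map_pow]; exact pow_le_one' (hw q hq) _
  have hu : ∀ q : FFPrime F K, q ≠ infty → q.v (1 - w ^ M) ≤ 1 := fun q hq =>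
    q.v.map_sub_le q.v.map_one.le (hMw q hq)
  have huP : ∀ q ∈ P, q.v (1 - w ^ M) < 1 := by
    intro q hq
    obtain ⟨l, hl⟩ : m q ∣ M := (Finset.dvd_prod_of_mem m hq).mul_left _
    have hgeom := (Commute.all (w ^ m q) 1).mul_geom_sum₂ l
    rw [Valuation.map_sub_swap, hl, pow_mul, ← one_pow l, ← hgeom, map_mul]
    refine (mul_le_of_le_one_right' ?_).trans_lt (hm q hq)
    refine Valuation.map_sum_le _ fun i _ => ?_
    rw [one_pow, mul_one, map_pow, map_pow, hPw q hq, one_pow, one_pow]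
  -- The power `k` removes the poles on `P`. It may be chosen after `M`, since `(1 - w ^ M) ^ k - 1`
  -- is divisible by `w ^ M` with an integral quotient at `p`, whatever `k` is.
  obtain ⟨k, hk⟩ := exists_forall_ge_forall_mem P
    (P := fun q n => q.v (1 - w ^ M) ^ n * q.v (a * e) ≤ 1) fun q hq => by
      obtain ⟨N, hN⟩ := exists_forall_ge_pow_mul_lt (huP q hq) (q.v (a * e)) one_ne_zero
      exact ⟨N, fun n hn => (hN n hn).le⟩
  refine ⟨a * e * (1 - w ^ M) ^ k, ?_, fun q hqp hq => ?_⟩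
  · have h1 : a * e * (1 - w ^ M) ^ k - a =
        a * e * ((1 - w ^ M) ^ k - 1 ^ k) + (a * e - a) := by ring
    rw [h1]
    refine Valuation.map_add_lt _ ?_ hap
    rw [← (Commute.all (1 - w ^ M) 1).mul_geom_sum₂ k, p.v.map_mul (a * e), mul_comm, map_mul]
    have h2 : p.v (1 - w ^ M - 1) = p.v w ^ M := by
      rw [show (1 - w ^ M - 1) = -w ^ M by ring, Valuation.map_neg, map_pow]
    rw [h2]
    refine lt_of_le_of_lt (mul_le_mul_left (mul_le_of_le_one_right' ?_) _) (hN M hNM)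
    refine Valuation.map_sum_le _ fun i _ => ?_
    rw [one_pow, mul_one, map_pow]
    exact pow_le_one' (hu p hp) _
  · rw [map_mul, map_pow, mul_comm]
    by_cases hqP : q ∈ P
    · exact hk q hqP k le_rfl
    · have : q.v (a * e) ≤ 1 := by
        by_contra hlt
        exact hqP (by
          simp only [hP, Finset.mem_erase, Set.Finite.mem_toFinset, Set.mem_ofPred_eq]
          exact ⟨hq, hqp, not_le.1 hlt⟩)
      exact mul_le_one' (pow_le_one' (hu q hq) _) this

end IsCurveFunctionField

end StrongApproximation

/-! ### Strong approximation for SL_n. -/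

section LocalMatrices

open Matrix

/-- The diagonal matrix with entries `c`, `c⁻¹` is a product of transvections. -/
theorem diag2n_eq_transvections {ι E : Type*} [Fintype ι] [DecidableEq ι] [Field E] {i j : ι}
    (hij : i ≠ j) {c : E} (hc : c ≠ 0) :
    SpecialLinearGroup.diag2n hij c hc =
      SpecialLinearGroup.transvection hij c * SpecialLinearGroup.transvection hij.symm (-c⁻¹) *
        SpecialLinearGroup.transvection hij c * SpecialLinearGroup.transvection hij (-1) *
        SpecialLinearGroup.transvection hij.symm 1 * SpecialLinearGroup.transvection hij (-1) := by
  -- Each triple product is a Weyl element; the diagonal matrix is the product of those for `c` and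
  -- `-1`.
  have weyl : ∀ d : E, d ≠ 0 → (transvection i j d * transvection j i (-d⁻¹) * transvection i j d
      : Matrix ι ι E) = 1 - single i i 1 - single j j 1 + single i j d - single j i d⁻¹ := by
    intro d hd
    simp only [transvection, mul_add, add_mul, single_mul_single_same, mul_one,
      single_mul_single_of_ne _ _ _ _ hij.symm, mul_neg, neg_mul, mul_inv_cancel₀ hd,
      inv_mul_cancel₀ hd, ← single_neg, one_mul, add_zero]
    abel
  apply Subtype.ext
  have h1 := weyl c hc
  have h2 := weyl (-1) (by simp)
  simp only [inv_neg, inv_one, neg_neg] at h2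
  rw [SpecialLinearGroup.diag2n_coe]
  change _ = transvection i j c * transvection j i (-c⁻¹) * transvection i j c *
    transvection i j (-1) * transvection j i 1 * transvection i j (-1)
  rw [Matrix.mul_assoc _ _ (transvection i j (-1)), Matrix.mul_assoc (_ * _) _ (_ * _),
    ← Matrix.mul_assoc (transvection i j (-1)), h1, h2]
  simp only [mul_add, mul_sub, add_mul, sub_mul, single_mul_single_same,
    single_mul_single_of_ne _ _ _ _ hij, single_mul_single_of_ne _ _ _ _ hij.symm, mul_neg,
    one_mul, mul_one]
  ext a b
  simp only [diagonal_apply, Matrix.add_apply, Matrix.sub_apply, single_apply, one_apply,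
    Matrix.zero_apply]
  grind

variable {F K : Type*} [Field F] [Field K] [Algebra F K] {n : ℕ}

namespace FFPrime

theorem valued_algebraMap (p : FFPrime F K) (a : K) :
    Valued.v (algebraMap K p.Completion a) = p.v a :=
  IsDedekindDomain.HeightOneSpectrum.valuedAdicCompletion_eq_valuation' _ a

/-- The matrices which are invertible over the complete valuation ring. -/
noncomputable abbrev integralGL (p : FFPrime F K) (n : ℕ) : Subgroup (GL (Fin n) p.Completion) :=
  (Matrix.GeneralLinearGroup.map (n := Fin n) p.completionIntegers.subtype).range

theorem valued_apply_le_one {p : FFPrime F K} {g : GL (Fin n) p.Completion}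
    (hg : g ∈ p.integralGL n) (i j : Fin n) : Valued.v (g i j) ≤ 1 := by
  obtain ⟨u, rfl⟩ := hg
  exact (u i j).2

theorem valued_det_le_one {p : FFPrime F K} {M : Matrix (Fin n) (Fin n) p.Completion}
    (hM : ∀ i j, Valued.v (M i j) ≤ 1) : Valued.v M.det ≤ 1 := by
  let M' : Matrix (Fin n) (Fin n) p.completionIntegers := Matrix.of fun i j => ⟨M i j, hM i j⟩
  have h : p.completionIntegers.subtype M'.det = M.det := RingHom.map_det _ _
  rw [← h]
  exact M'.det.2

theorem mem_integralGL_of_det {p : FFPrime F K} {g : GL (Fin n) p.Completion}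
    (hg : ∀ i j, Valued.v (g i j) ≤ 1)
    (hdet : Valued.v (g : Matrix (Fin n) (Fin n) p.Completion).det = 1) : g ∈ p.integralGL n := by
  let M : Matrix (Fin n) (Fin n) p.completionIntegers := Matrix.of fun i j => ⟨g i j, hg i j⟩
  have hM : M.map p.completionIntegers.subtype = g := rfl
  have hMdet : p.completionIntegers.subtype M.det = (g : Matrix (Fin n) (Fin n) p.Completion).det := by
    rw [RingHom.map_det, RingHom.mapMatrix_apply, hM]
  have hne : (g : Matrix (Fin n) (Fin n) p.Completion).det ≠ 0 := by
    intro h; rw [h] at hdet; simp at hdet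
  have hunit : IsUnit M.det := by
    have hinv : Valued.v (g : Matrix (Fin n) (Fin n) p.Completion).det⁻¹ ≤ 1 := by
      rw [map_inv₀, hdet, inv_one]
    refine IsUnit.of_mul_eq_one (⟨_, hinv⟩ : p.completionIntegers) (Subtype.ext ?_)
    change p.completionIntegers.subtype M.det * _ = 1
    rw [hMdet]
    exact mul_inv_cancel₀ hne
  exact ⟨Matrix.GeneralLinearGroup.mk'' M hunit, Units.ext hM⟩

theorem mem_integralGL {p : FFPrime F K} {g : GL (Fin n) p.Completion}
    (hg : ∀ i j, Valued.v (g i j) ≤ 1) (hg' : ∀ i j, Valued.v (g⁻¹ i j) ≤ 1) :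
    g ∈ p.integralGL n := by
  refine mem_integralGL_of_det hg ?_
  have h1 := valued_det_le_one hg
  have h2 := valued_det_le_one hg'
  have h3 : (g : Matrix (Fin n) (Fin n) p.Completion).det *
      (g⁻¹ : GL (Fin n) p.Completion).val.det = 1 := by
    rw [← Matrix.det_mul, Units.mul_inv, Matrix.det_one]
  have h4 := congrArg Valued.v h3
  rw [map_mul, map_one] at h4
  refine le_antisymm h1 ?_
  rw [← h4]
  exact mul_le_of_le_one_right' h2

/-- The image of `K` in the completion at `p` of elements integral at all primes except `p` and
`infty` is dense. -/
theorem dense_strong (hK : IsCurveFunctionField F K) [Finite F] {infty p : FFPrime F K}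
    (hp : p ≠ infty) (a : p.Completion) :
    a ∈ closure (algebraMap K p.Completion '' {r | ∀ q, q ≠ p → q ≠ infty → q.v r ≤ 1}) := by
  rw [mem_closure_iff]
  intro U hU ha
  obtain ⟨b, hb⟩ := (IsDedekindDomain.HeightOneSpectrum.denseRange_algebraMap K
    (IsDiscreteValuationRing.maximalIdeal p.valRing)).exists_mem_open hU ⟨a, ha⟩
  obtain ⟨γ, hγ⟩ := Valued.mem_nhds.1 (hU.mem_nhds hb)
  obtain ⟨r, hr, hr'⟩ := hK.exists_strong_approx hp b
    (ε := MonoidWithZeroHom.ValueGroup₀.embedding γ.1) (by simp)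
  refine ⟨algebraMap K p.Completion r, hγ ?_, r, hr', rfl⟩
  change Valued.v.restrict _ < γ.1
  rw [Valuation.restrict_lt_iff_lt_embedding, ← map_sub]
  exact (p.valued_algebraMap _).trans_lt hr

/-- The matrices over `K` of determinant one with entries integral at all primes except `p` and
`infty`, as a monoid of matrices over the completion at `p`. -/
noncomputable def strongSL (infty p : FFPrime F K) (n : ℕ) :
    Submonoid (Matrix (Fin n) (Fin n) p.Completion) where
  carrier := {M | ∃ N : Matrix (Fin n) (Fin n) K, N.det = 1 ∧
    (∀ q, q ≠ p → q ≠ infty → ∀ i j, q.v (N i j) ≤ 1) ∧ N.map (algebraMap K p.Completion) = M}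
  mul_mem' := by
    rintro _ _ ⟨N, hN, hN', rfl⟩ ⟨M, hM, hM', rfl⟩
    refine ⟨N * M, by rw [Matrix.det_mul, hN, hM, one_mul], fun q hq hq' i j => ?_,
      Matrix.map_mul⟩
    rw [Matrix.mul_apply]
    refine Valuation.map_sum_le _ fun k _ => ?_
    rw [map_mul]
    exact mul_le_one' (hN' q hq hq' i k) (hM' q hq hq' k j)
  one_mem' := by
    refine ⟨1, Matrix.det_one, fun q _ _ i j => ?_, Matrix.map_one _ (map_zero _) (map_one _)⟩
    rw [Matrix.one_apply]
    split_ifs <;> simp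

/-- The closure of a submonoid is a submonoid, so it suffices to reach generators of SL_n.
Transvections are limits of global ones by `dense_strong`, and the diagonal generators are products
of transvections. -/
theorem mem_closure_strongSL [Nontrivial (Fin n)] (hK : IsCurveFunctionField F K) [Finite F]
    {infty p : FFPrime F K} (hp : p ≠ infty) (A : SpecialLinearGroup (Fin n) p.Completion) :
    (A : Matrix (Fin n) (Fin n) p.Completion) ∈ (strongSL infty p n).topologicalClosure := by
  have htr : ∀ (i j : Fin n) (hij : i ≠ j) (a : p.Completion),
      (SpecialLinearGroup.transvection hij a : Matrix (Fin n) (Fin n) p.Completion) ∈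
        (strongSL infty p n).topologicalClosure := by
    intro i j hij a
    have hcont : Continuous fun a : p.Completion => Matrix.transvection i j a := by
      refine continuous_const.add (continuous_matrix fun k l => ?_)
      simp only [Matrix.single_apply]
      split_ifs
      · exact continuous_id
      · exact continuous_const
    refine closure_mono ?_ (image_closure_subset_closure_image hcont ⟨a, dense_strong hK hp a, rfl⟩)
    rintro _ ⟨_, ⟨r, hr, rfl⟩, rfl⟩
    refine ⟨Matrix.transvection i j r, Matrix.det_transvection_of_ne i j hij r,
      fun q hq hq' k l => ?_, ?_⟩
    · rw [Matrix.transvection, Matrix.add_apply]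
      refine Valuation.map_add_le _ ?_ ?_
      · rw [Matrix.one_apply]; split_ifs <;> simp
      · rw [Matrix.single_apply]
        split_ifs
        · exact hr q hq hq'
        · simp
    · ext k l
      simp only [Matrix.transvection, Matrix.map_apply, Matrix.add_apply, map_add,
        Matrix.one_apply, Matrix.single_apply]
      split_ifs <;> simp
  refine SpecialLinearGroup.diagonal_transvection_induction'
    (fun A => (A : Matrix (Fin n) (Fin n) p.Completion) ∈ (strongSL infty p n).topologicalClosure) A
    (fun i j hij c hc => ?_) htr fun A B hA hB => ?_
  · rw [diag2n_eq_transvections hij hc]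
    exact mul_mem (mul_mem (mul_mem (mul_mem (mul_mem (htr _ _ _ _) (htr _ _ _ _)) (htr _ _ _ _))
      (htr _ _ _ _)) (htr _ _ _ _)) (htr _ _ _ _)
  · exact mul_mem hA hB

/-- A local matrix with unit determinant can be made integral by a global matrix of determinant
one which is integral at all other primes different from `infty`. -/
theorem exists_mul_mem_integralGL (hK : IsCurveFunctionField F K) [Finite F]
    {infty p : FFPrime F K} (hp : p ≠ infty) (y : GL (Fin n) p.Completion)
    (hy : Valued.v (y : Matrix (Fin n) (Fin n) p.Completion).det = 1) :
    ∃ h : GL (Fin n) K, (h : Matrix (Fin n) (Fin n) K).det = 1 ∧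
      y * Matrix.GeneralLinearGroup.map (algebraMap K p.Completion) h ∈ p.integralGL n ∧
      ∀ q, q ≠ p → q ≠ infty →
        Matrix.GeneralLinearGroup.map (algebraMap K q.Completion) h ∈ q.integralGL n := by
  rcases subsingleton_or_nontrivial (Fin n) with hn | hn
  · refine ⟨1, by simp, ?_, fun q _ _ => by rw [map_one]; exact one_mem _⟩
    rw [map_one, mul_one]
    refine mem_integralGL_of_det (fun i j => ?_) hy
    rw [Subsingleton.elim j i, ← Matrix.det_eq_elem_of_subsingleton y.val i, hy]
  obtain ⟨i₀⟩ : Nonempty (Fin n) := inferInstance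
  set d := (y : Matrix (Fin n) (Fin n) p.Completion).det with hd
  have hd0 : d ≠ 0 := by intro h; rw [h] at hy; simp at hy
  -- `E` is integral with the determinant of `y`, so `y⁻¹ * E` has determinant 1 and can be
  -- approximated by a global `N`. As `y * (y⁻¹ * E) = E` is integral and integrality is an open
  -- condition, `y * N` is integral too.
  let E : Matrix (Fin n) (Fin n) p.Completion := Matrix.diagonal (Function.update 1 i₀ d)
  have hE : E.det = d := by
    simp [E, Matrix.det_diagonal, Finset.prod_update_of_mem]
  have hAdet : ((y⁻¹ : GL (Fin n) p.Completion).val * E).det = 1 := by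
    have h3 : (y⁻¹ : GL (Fin n) p.Completion).val.det * d = 1 := by
      rw [hd, ← Matrix.det_mul, Units.inv_mul, Matrix.det_one]
    rw [Matrix.det_mul, hE, h3]
  have hA := mem_closure_strongSL hK hp
    (⟨(y⁻¹ : GL (Fin n) p.Completion).val * E, hAdet⟩ : SpecialLinearGroup (Fin n) p.Completion)
  have hopen : IsOpen {M : Matrix (Fin n) (Fin n) p.Completion |
      ∀ i j, (y.val * M) i j ∈ (p.completionIntegers : Set p.Completion)} := by
    simp only [Set.ofPred_forall]
    refine isOpen_iInter_of_finite fun i => isOpen_iInter_of_finite fun j => ?_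
    exact (Valued.isOpen_valuationSubring p.Completion).preimage
      ((continuous_const.matrix_mul continuous_id).matrix_elem i j)
  obtain ⟨_, hM, N, hN, hN', rfl⟩ := mem_closure_iff.1 hA _ hopen (by
    intro i j
    rw [← Matrix.mul_assoc, Units.mul_inv, Matrix.one_mul]
    change Valued.v (E i j) ≤ 1
    simp only [E, Matrix.diagonal_apply, Function.update_apply]
    split_ifs <;> simp [hy])
  refine ⟨Matrix.GeneralLinearGroup.mkOfDetNeZero N (by simp [hN]), hN, ?_, fun q hq hq' => ?_⟩
  · refine mem_integralGL_of_det hM ?_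
    change Valued.v (y.val * N.map (algebraMap K p.Completion)).det = 1
    rw [Matrix.det_mul, ← RingHom.mapMatrix_apply, ← RingHom.map_det, hN, map_one, mul_one, hy]
  · refine mem_integralGL_of_det (fun i j => ?_) ?_
    · exact (q.valued_algebraMap _).trans_le (hN' q hq hq' i j)
    · change Valued.v (N.map (algebraMap K q.Completion)).det = 1
      rw [← RingHom.mapMatrix_apply, ← RingHom.map_det, hN, map_one, map_one]

end FFPrime

open FFPrime in
/-- A family of local matrices with unit determinants, almost all of them integral, becomes
integral away from `infty` after multiplication by a global matrix. -/
theorem exists_global_mul_mem_integralGL (hK : IsCurveFunctionField F K) [Finite F]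
    (infty : FFPrime F K) (S : Finset (FFPrime F K)) (x : ∀ p : FFPrime F K, GL (Fin n) p.Completion)
    (hdet : ∀ p ≠ infty, Valued.v (x p : Matrix (Fin n) (Fin n) p.Completion).det = 1)
    (hx : ∀ p ∉ S, p ≠ infty → x p ∈ p.integralGL n) :
    ∃ h : GL (Fin n) K, ∀ p ≠ infty,
      x p * Matrix.GeneralLinearGroup.map (algebraMap K p.Completion) h ∈ p.integralGL n := by
  classical
  induction S using Finset.induction_on generalizing x with
  | empty => exact ⟨1, fun p hp => by rw [map_one, mul_one]; exact hx p (by simp) hp⟩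
  | insert p S _ ih =>
    by_cases hp : p = infty
    · refine ih x hdet fun q hq hq' => hx q ?_ hq'
      rw [Finset.mem_insert, not_or]
      exact ⟨hp ▸ hq', hq⟩
    · obtain ⟨h₁, hd₁, hp₁, hq₁⟩ := exists_mul_mem_integralGL hK hp (x p) (hdet p hp)
      obtain ⟨h₂, hh₂⟩ := ih
        (fun q => x q * Matrix.GeneralLinearGroup.map (algebraMap K q.Completion) h₁)
        (fun q hq => by
          change Valued.v ((x q).val * h₁.val.map (algebraMap K q.Completion)).det = 1
          rw [Matrix.det_mul, ← RingHom.mapMatrix_apply, ← RingHom.map_det, hd₁, map_one, mul_one,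
            hdet q hq])
        (fun q hq hq' => by
          by_cases hqp : q = p
          · subst hqp; exact hp₁
          · exact mul_mem (hx q (by simp [hqp, hq]) hq') (hq₁ q hqp hq'))
      refine ⟨h₁ * h₂, fun q hq => ?_⟩
      rw [map_mul, ← mul_assoc]
      exact hh₂ q hq

end LocalMatrices

/-! ### Gram matrices under change of basis. -/

section Congruence

open Matrix

variable {R S : Type*} [CommRing R] [CommRing S] {n : ℕ}

/-- The right action of `GL n` on Gram matrices by change of basis. -/
def gramAct (B : Matrix (Fin n) (Fin n) R) (g : GL (Fin n) R) : Matrix (Fin n) (Fin n) R :=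
  (g : Matrix (Fin n) (Fin n) R)ᵀ * B * (g : Matrix (Fin n) (Fin n) R)

theorem gramAct_one (B : Matrix (Fin n) (Fin n) R) : gramAct B 1 = B := by
  simp [gramAct]

theorem gramAct_mul (B : Matrix (Fin n) (Fin n) R) (g h : GL (Fin n) R) :
    gramAct B (g * h) = gramAct (gramAct B g) h := by
  simp only [gramAct, Units.val_mul, Matrix.transpose_mul, Matrix.mul_assoc]

theorem gramAct_eq_iff {B C : Matrix (Fin n) (Fin n) R} {g : GL (Fin n) R} :
    gramAct B g = C ↔ B = gramAct C g⁻¹ := by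
  constructor
  · rintro rfl
    rw [← gramAct_mul, mul_inv_cancel, gramAct_one]
  · rintro rfl
    rw [← gramAct_mul, inv_mul_cancel, gramAct_one]

theorem gramAct_map (φ : R →+* S) (B : Matrix (Fin n) (Fin n) R) (g : GL (Fin n) R) :
    (gramAct B g).map φ = gramAct (B.map φ) (Matrix.GeneralLinearGroup.map φ g) := by
  simp only [gramAct, Matrix.map_mul, Matrix.transpose_map]
  rfl

theorem mem_orthogonalPoints {φ : R →+* S} {f : LinearMap.BilinForm R (Fin n → R)}
    {g : GL (Fin n) S} : g ∈ orthogonalPoints φ f ↔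
      gramAct ((LinearMap.BilinForm.toMatrix' f).map φ) g =
        (LinearMap.BilinForm.toMatrix' f).map φ := Iff.rfl

theorem formIso_iff {f g : LinearMap.BilinForm R (Fin n → R)} :
    FormIso f g ↔ ∃ Q : GL (Fin n) R, LinearMap.BilinForm.toMatrix' f =
      gramAct (LinearMap.BilinForm.toMatrix' g) Q := by
  constructor
  · rintro ⟨Q, hQ⟩
    refine ⟨⟨LinearMap.toMatrix' Q.toLinearMap, LinearMap.toMatrix' Q.symm.toLinearMap, ?_, ?_⟩, ?_⟩
    · rw [← LinearMap.toMatrix'_comp]; simp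
    · rw [← LinearMap.toMatrix'_comp]; simp
    · have : f = g.comp Q.toLinearMap Q.toLinearMap := LinearMap.ext₂ hQ
      rw [this, LinearMap.BilinForm.toMatrix'_comp]
      rfl
  · rintro ⟨Q, hQ⟩
    refine ⟨Matrix.toLin'OfInv (Units.inv_mul Q) (Units.mul_inv Q), fun u v => ?_⟩
    have : f = g.comp (Matrix.toLin' Q.val) (Matrix.toLin' Q.val) := by
      apply LinearMap.BilinForm.toMatrix'.injective
      rw [LinearMap.BilinForm.toMatrix'_comp, hQ]
      simp [gramAct]
    rw [this]
    rfl

theorem toMatrix'_extendForm (φ : R →+* S) (f : LinearMap.BilinForm R (Fin n → R)) :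
    LinearMap.BilinForm.toMatrix' (extendForm φ f) = (LinearMap.BilinForm.toMatrix' f).map φ :=
  LinearMap.BilinForm.toMatrix'_toBilin' _

theorem formIso_extendForm_iff {φ : R →+* S} {f g : LinearMap.BilinForm R (Fin n → R)} :
    FormIso (extendForm φ f) (extendForm φ g) ↔ ∃ Q : GL (Fin n) S,
      (LinearMap.BilinForm.toMatrix' f).map φ =
        gramAct ((LinearMap.BilinForm.toMatrix' g).map φ) Q := by
  rw [formIso_iff, toMatrix'_extendForm, toMatrix'_extendForm]

/-- Two quotients related by a correspondence are in bijection. -/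
theorem nonempty_quotient_equiv {X Y : Type*} {r : Setoid X} {s : Setoid Y} (C : X → Y → Prop)
    (hX : ∀ x, ∃ y, C x y) (hY : ∀ y, ∃ x, C x y)
    (h : ∀ x y x' y', C x y → C x' y' → (r x x' ↔ s y y')) :
    Nonempty (Quotient r ≃ Quotient s) := by
  choose F hF using hX
  refine ⟨Equiv.ofBijective (Quotient.map F fun x x' hx => (h _ _ _ _ (hF x) (hF x')).1 hx)
    ⟨?_, ?_⟩⟩
  · rintro ⟨x⟩ ⟨x'⟩ hxx
    exact Quotient.sound ((h _ _ _ _ (hF x) (hF x')).2 (Quotient.exact hxx))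
  · rintro ⟨y⟩
    obtain ⟨x, hx⟩ := hY y
    exact ⟨⟦x⟧, Quotient.sound ((h _ _ _ _ (hF x) hx).1 (r.refl x))⟩

end Congruence

/-! ### The correspondence between adelic points and forms in the genus. -/

section ClassSet

open Matrix

variable {F K : Type*} [Field F] [Field K] [Algebra F K] {n : ℕ}

theorem mem_integersAwayFrom_iff {infty : FFPrime F K} {a : K} :
    a ∈ integersAwayFrom infty ↔ ∀ p ≠ infty, p.v a ≤ 1 :=
  forall₂_congr fun p _ => p.v_le_one_iff.symm

theorem mem_integralGL_map_iff {p : FFPrime F K} {g : GL (Fin n) K} :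
    Matrix.GeneralLinearGroup.map (algebraMap K p.Completion) g ∈ p.integralGL n ↔
      (∀ i j, p.v (g i j) ≤ 1) ∧ ∀ i j, p.v (g⁻¹ i j) ≤ 1 := by
  constructor
  · intro h
    refine ⟨fun i j => ?_, fun i j => ?_⟩
    · rw [← p.valued_algebraMap]
      exact FFPrime.valued_apply_le_one h i j
    · have h' := inv_mem h
      rw [← map_inv] at h'
      rw [← p.valued_algebraMap]
      exact FFPrime.valued_apply_le_one h' i j
  · rintro ⟨h, h'⟩
    refine FFPrime.mem_integralGL (fun i j => ?_) fun i j => ?_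
    · exact (p.valued_algebraMap _).trans_le (h i j)
    · rw [← map_inv]
      exact (p.valued_algebraMap _).trans_le (h' i j)

/-- A matrix over `K` is integral at almost all primes. -/
theorem IsCurveFunctionField.eventually_mem_integralGL (hK : IsCurveFunctionField F K)
    (g : GL (Fin n) K) : ∀ᶠ p : FFPrime F K in Filter.cofinite,
      Matrix.GeneralLinearGroup.map (algebraMap K p.Completion) g ∈ p.integralGL n := by
  have h (a : K) : ∀ᶠ p : FFPrime F K in Filter.cofinite, p.v a ≤ 1 := by
    rw [Filter.eventually_cofinite]
    simpa only [not_le] using hK.finite_setOf_one_lt a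
  filter_upwards [Filter.eventually_all.2 fun i => Filter.eventually_all.2 fun j => h (g i j),
    Filter.eventually_all.2 fun i => Filter.eventually_all.2 fun j => h (g⁻¹ i j)] with p h1 h2
  exact mem_integralGL_map_iff.2 ⟨h1, h2⟩

/-- A matrix over `K` with entries in the `{infty}`-integers lifts. -/
theorem exists_map_subtype_eq {infty : FFPrime F K} {M : Matrix (Fin n) (Fin n) K}
    (hM : ∀ p ≠ infty, ∀ i j, p.v (M i j) ≤ 1) :
    ∃ N : Matrix (Fin n) (Fin n) (integersAwayFrom infty),
      N.map (integersAwayFrom infty).subtype = M :=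
  ⟨Matrix.of fun i j => ⟨M i j, mem_integersAwayFrom_iff.2 fun p hp => hM p hp i j⟩, rfl⟩

theorem exists_generalLinearGroup_map_subtype_eq {infty : FFPrime F K} {g : GL (Fin n) K}
    (hg : ∀ p ≠ infty,
      Matrix.GeneralLinearGroup.map (algebraMap K p.Completion) g ∈ p.integralGL n) :
    ∃ w : GL (Fin n) (integersAwayFrom infty),
      Matrix.GeneralLinearGroup.map (integersAwayFrom infty).subtype w = g := by
  obtain ⟨M, hM⟩ := exists_map_subtype_eq (M := g.val) fun p hp =>
    (mem_integralGL_map_iff.1 (hg p hp)).1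
  obtain ⟨N, hN⟩ := exists_map_subtype_eq (M := (g⁻¹ : GL (Fin n) K).val) fun p hp =>
    (mem_integralGL_map_iff.1 (hg p hp)).2
  have hinj : Function.Injective fun M : Matrix (Fin n) (Fin n) (integersAwayFrom infty) =>
      M.map (integersAwayFrom infty).subtype := Matrix.map_injective Subtype.val_injective
  refine ⟨⟨M, N, hinj ?_, hinj ?_⟩, Units.ext hM⟩
  · change (M * N).map _ = (1 : Matrix _ _ _).map _
    rw [Matrix.map_mul, hM, hN, Units.mul_inv, Matrix.map_one _ (map_zero _) (map_one _)]
  · change (N * M).map _ = (1 : Matrix _ _ _).map _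
    rw [Matrix.map_mul, hM, hN, Units.inv_mul, Matrix.map_one _ (map_zero _) (map_one _)]

theorem map_subtype_mem_integralGL {infty p : FFPrime F K} (hp : p ≠ infty)
    (w : GL (Fin n) (integersAwayFrom infty)) :
    Matrix.GeneralLinearGroup.map (algebraMap K p.Completion)
      (Matrix.GeneralLinearGroup.map (integersAwayFrom infty).subtype w) ∈ p.integralGL n :=
  ⟨Matrix.GeneralLinearGroup.map (toCompletionIntegers infty p hp) w, rfl⟩

variable {infty : FFPrime F K}

/-- The adelic point `x` and the form `g` correspond via a matrix `h` over `K`: it makes `x`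
integral away from `infty` and transforms `f` into `g`. -/
def Corresponds (f : IntegralForm infty n) (x : AdelicPoints f) (g : Genus f) : Prop :=
  ∃ h : GL (Fin n) K,
    (∀ p ≠ infty, (x p : GL (Fin n) p.Completion) *
      Matrix.GeneralLinearGroup.map (algebraMap K p.Completion) h ∈ p.integralGL n) ∧
    (LinearMap.BilinForm.toMatrix' g.1.1).map (integersAwayFrom infty).subtype =
      gramAct ((LinearMap.BilinForm.toMatrix' f.1).map (integersAwayFrom infty).subtype) h

theorem mem_integralLocalPoints {f : IntegralForm infty n} {p : FFPrime F K}
    {x : LocalPoints f p} : x ∈ integralLocalPoints f p ↔ x.1 ∈ p.integralGL n := Iff.rfl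

/-- Taking determinants in xᵗAx = A and cancelling det A ≠ 0 gives (det x)² = 1. This is where
nondegeneracy enters, and it removes the class group obstruction. -/
theorem valued_det_localPoint {f : IntegralForm infty n} (hf : f.1.Nondegenerate)
    {p : FFPrime F K} (x : LocalPoints f p) :
    Valued.v (x.1 : Matrix (Fin n) (Fin n) p.Completion).det = 1 := by
  have hdet : (LinearMap.BilinForm.toMatrix' f.1).det ≠ 0 := by
    rw [← LinearMap.BilinForm.nondegenerate_toBilin'_iff_det_ne_zero,
      Matrix.toBilin'_toMatrix']
    exact hf
  have hinj : Function.Injective (toCompletion infty p) :=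
    (algebraMap K p.Completion).injective.comp Subtype.val_injective
  have h := congrArg Matrix.det (mem_orthogonalPoints.1 x.2)
  rw [gramAct, Matrix.det_mul, Matrix.det_mul, Matrix.det_transpose, ← RingHom.mapMatrix_apply,
    ← RingHom.map_det] at h
  have hne : toCompletion infty p (LinearMap.BilinForm.toMatrix' f.1).det ≠ 0 :=
    (map_ne_zero_iff _ hinj).2 hdet
  have h2 : x.1.val.det * x.1.val.det = 1 := by
    refine mul_right_cancel₀ hne ?_
    rw [one_mul]
    exact Eq.trans (by ring) h
  have h3 := congrArg Valued.v h2
  rw [map_mul, map_one, ← sq] at h3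
  exact (pow_eq_one_iff_of_nonneg zero_le two_ne_zero).1 h3

theorem exists_corresponds_right (hK : IsCurveFunctionField F K) [Finite F]
    {f : IntegralForm infty n} (hf : f.1.Nondegenerate) (x : AdelicPoints f) :
    ∃ g : Genus f, Corresponds f x g := by
  obtain ⟨h, hh⟩ := exists_global_mul_mem_integralGL hK infty
    (Filter.eventually_cofinite.1 x.2).toFinset (fun p => (x p).1)
    (fun p _ => valued_det_localPoint hf (x p)) (fun p hp _ => by
      by_contra hmem
      exact hp ((Set.Finite.mem_toFinset _).2 hmem))
  set A := LinearMap.BilinForm.toMatrix' f.1 with hA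
  set ι := (integersAwayFrom infty).subtype
  -- With u = x_p h, invariance of A under x_p turns hᵗAh into uᵗAu. This gives both integrality at
  -- `p` and the local isomorphism.
  have key : ∀ p (hp : p ≠ infty), ∃ u : GL (Fin n) p.completionIntegers,
      (gramAct (A.map ι) h).map (algebraMap K p.Completion) =
        (gramAct (A.map (toCompletionIntegers infty p hp)) u).map p.completionIntegers.subtype := by
    intro p hp
    obtain ⟨u, hu⟩ := hh p hp
    refine ⟨u, ?_⟩
    rw [gramAct_map, gramAct_map, hu, gramAct_mul]
    congr 1
    exact (mem_orthogonalPoints.1 (x p).2).symm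
  obtain ⟨G, hG⟩ := exists_map_subtype_eq (infty := infty) (M := gramAct (A.map ι) h) fun p hp i j => by
    obtain ⟨u, hu⟩ := key p hp
    rw [← p.valued_algebraMap]
    have := congrFun (congrFun hu i) j
    simp only [Matrix.map_apply] at this
    rw [this]
    exact (gramAct (A.map (toCompletionIntegers infty p hp)) u i j).2
  have hAt : Aᵀ = A := LinearMap.BilinForm.isSymm_toMatrix'_iff_isSymm.2 f.2
  have hGt : Gᵀ = G := by
    apply Matrix.map_injective (f := ι) Subtype.val_injective
    change Gᵀ.map ι = G.map ι
    rw [Matrix.transpose_map, hG, gramAct, Matrix.transpose_mul, Matrix.transpose_mul,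
      Matrix.transpose_transpose, ← Matrix.transpose_map, hAt, Matrix.mul_assoc]
  have hGm : LinearMap.BilinForm.toMatrix' (Matrix.toBilin' G) = G :=
    LinearMap.BilinForm.toMatrix'_toBilin' _
  have hsymm : (Matrix.toBilin' G).IsSymm := Matrix.isSymm_toBilin'_iff_isSymm.2 hGt
  refine ⟨⟨⟨Matrix.toBilin' G, hsymm⟩, FormIso.equivalence.symm (formIso_extendForm_iff.2 ⟨h, ?_⟩),
    fun p hp => FormIso.equivalence.symm (formIso_extendForm_iff.2 ?_)⟩, h, hh, ?_⟩
  · rw [hGm]; exact hG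
  · obtain ⟨u, hu⟩ := key p hp
    refine ⟨u, Matrix.map_injective (f := p.completionIntegers.subtype) Subtype.val_injective ?_⟩
    rw [hGm]
    refine Eq.trans ?_ hu
    rw [← hG]
    rfl
  · change (LinearMap.BilinForm.toMatrix' (Matrix.toBilin' G)).map ι = _
    rw [hGm, hG]

theorem exists_corresponds_left (hK : IsCurveFunctionField F K) (f : IntegralForm infty n)
    (g : Genus f) : ∃ x : AdelicPoints f, Corresponds f x g := by
  classical
  obtain ⟨h, hh⟩ := formIso_extendForm_iff.1 (FormIso.equivalence.symm g.2.1)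
  have hloc := fun p hp => formIso_extendForm_iff.1 (FormIso.equivalence.symm (g.2.2 p hp))
  choose u hu using hloc
  let y : ∀ p : FFPrime F K, p ≠ infty → LocalPoints f p := fun p hp =>
    ⟨Matrix.GeneralLinearGroup.map p.completionIntegers.subtype (u p hp) *
      (Matrix.GeneralLinearGroup.map (algebraMap K p.Completion) h)⁻¹, by
      rw [mem_orthogonalPoints, gramAct_mul, eq_comm, ← gramAct_eq_iff]
      have h1 := congrArg (fun M => M.map (algebraMap K p.Completion)) hh
      have h2 := congrArg (fun M => M.map p.completionIntegers.subtype) (hu p hp)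
      simp only [gramAct_map] at h1 h2
      exact h1.symm.trans h2⟩
  -- The correspondence imposes nothing at `infty`, so 1 serves there. Since the local isomorphisms
  -- are integral, almost everywhere integrality is inherited from `h`.
  refine ⟨⟨fun p => if hp : p ≠ infty then y p hp else 1, ?_⟩, h, fun p hp => ?_, hh⟩
  · filter_upwards [hK.eventually_mem_integralGL h] with p hp
    split_ifs with hpi
    · exact mem_integralLocalPoints.2 (mul_mem ⟨_, rfl⟩ (inv_mem hp))
    · exact one_mem _
  · change ((if hp : p ≠ infty then y p hp else 1 : LocalPoints f p) : GL (Fin n) p.Completion) * _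
      ∈ _
    rw [dif_pos hp, inv_mul_cancel_right]
    exact ⟨_, rfl⟩

/-- A `K`-point of the orthogonal group as an adelic point. -/
noncomputable def toAdelic (hK : IsCurveFunctionField F K) (f : IntegralForm infty n)
    {γ : GL (Fin n) K} (hγ : γ ∈ orthogonalPoints (integersAwayFrom infty).subtype f.1) :
    AdelicPoints f :=
  ⟨fun p => ⟨Matrix.GeneralLinearGroup.map (algebraMap K p.Completion) γ, by
    have := congrArg (fun M => M.map (algebraMap K p.Completion)) (mem_orthogonalPoints.1 hγ)
    simp only [gramAct_map] at this
    exact this⟩, hK.eventually_mem_integralGL γ⟩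

theorem Corresponds.rel_iff (hK : IsCurveFunctionField F K) {f : IntegralForm infty n}
    {x x' : AdelicPoints f} {g g' : Genus f} (hx : Corresponds f x g) (hx' : Corresponds f x' g') :
    DoubleCoset.setoid (integralAdelicPoints f : Set (AdelicPoints f)) (rationalPoints f) x x' ↔
      genusSetoid f g g' := by
  obtain ⟨h, hu, hg⟩ := hx
  obtain ⟨h', hu', hg'⟩ := hx'
  rw [DoubleCoset.rel_iff]
  change _ ↔ FormIso g.1.1 g'.1.1
  rw [formIso_iff]
  constructor
  · rintro ⟨a, ha, b, ⟨γ, hγ, hb⟩, rfl⟩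
    -- With x' = a x γ, u = x h and u' = x' h', the global matrix h'⁻¹γ⁻¹h equals u'⁻¹ a u at each
    -- `p ≠ infty`.
    have hint : ∀ p ≠ infty, Matrix.GeneralLinearGroup.map (algebraMap K p.Completion)
        (h'⁻¹ * γ⁻¹ * h) ∈ p.integralGL n := by
      intro p hp
      have h1 := hu' p hp
      change ((a p).1 * (x p).1 * (b p).1) * _ ∈ _ at h1
      rw [hb p] at h1
      have h2 := mul_mem (mul_mem (inv_mem h1) (mem_integralLocalPoints.1 (ha p hp))) (hu p hp)
      convert h2 using 1
      simp only [map_mul, map_inv]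
      group
    obtain ⟨w, hw⟩ := exists_generalLinearGroup_map_subtype_eq hint
    refine ⟨w, Matrix.map_injective (f := (integersAwayFrom infty).subtype)
      Subtype.val_injective ?_⟩
    refine hg.trans (Eq.trans ?_ (gramAct_map _ _ _).symm)
    rw [ hw, hg', ← gramAct_mul, show h' * (h'⁻¹ * γ⁻¹ * h) = γ⁻¹ * h by group, gramAct_mul,
      mem_orthogonalPoints.1 (inv_mem hγ)]
  · rintro ⟨w, hw⟩
    set wK := Matrix.GeneralLinearGroup.map (integersAwayFrom infty).subtype w with hwK
    have hwK' := congrArg (fun M => M.map (integersAwayFrom infty).subtype) hw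
    simp only [gramAct_map] at hwK'
    rw [← hwK, hg, hg', ← gramAct_mul] at hwK'
    -- Solving w = h'⁻¹γ⁻¹h for γ. The left factor a = x'γ⁻¹x⁻¹ is then u' w u⁻¹ away from `infty`,
    -- hence integral.
    have hγ : h * wK⁻¹ * h'⁻¹ ∈ orthogonalPoints (integersAwayFrom infty).subtype f.1 := by
      rw [mem_orthogonalPoints, mul_assoc, gramAct_mul, hwK', ← gramAct_mul]
      rw [show h' * wK * (wK⁻¹ * h'⁻¹) = 1 by group, gramAct_one]
    refine ⟨x' * (toAdelic hK f hγ)⁻¹ * x⁻¹, fun p hp => ?_, toAdelic hK f hγ,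
      ⟨_, hγ, fun p => rfl⟩, by group⟩
    rw [mem_integralLocalPoints]
    change (x' p).1 * (Matrix.GeneralLinearGroup.map (algebraMap K p.Completion)
      (h * wK⁻¹ * h'⁻¹))⁻¹ * (x p).1⁻¹ ∈ _
    have h2 := mul_mem (mul_mem (hu' p hp) (map_subtype_mem_integralGL hp w)) (inv_mem (hu p hp))
    convert h2 using 1
    simp only [map_mul, map_inv, ← hwK]
    group

end ClassSet

end FunctionFieldForms

theorem mainTheorem5 {F K : Type*} [Field F] [Finite F] [Field K] [Algebra F K]
    (hF : Odd (Nat.card F)) (hK : FunctionFieldForms.IsCurveFunctionField F K)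
    (infty : FunctionFieldForms.FFPrime F K) (n : ℕ)
    (f : FunctionFieldForms.IntegralForm infty n) (hf : f.1.Nondegenerate) :
    FunctionFieldForms.genusClassCard f = FunctionFieldForms.classNumber f := by
  obtain ⟨e⟩ := FunctionFieldForms.nonempty_quotient_equiv (FunctionFieldForms.Corresponds f)
    (FunctionFieldForms.exists_corresponds_right hK hf)
    (FunctionFieldForms.exists_corresponds_left hK f)
    (fun x y x' y' hx hx' => FunctionFieldForms.Corresponds.rel_iff hK hx hx')
  exact (Cardinal.mk_congr e).symm
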